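/- **Setting.** Let $\mathfrak t$ be a finite-dimensional real vector space with inner product $\cdot$, let $\mathfrak t=\mathfrak t_1\oplus\cdots\oplus\mathfrak t_m$ be an orthogonal decomposition, and let $\Pi\subset\mathfrak t$ be a full-rank lattice with $\Pi\cdot\Pi\subset\mathbb Z$ and $\Pi=\bigoplus_i(\Pi\cap\mathfrak t_i)$. (For instance, $\mathfrak t$ is the Lie algebra of a maximal torus of a compact, connected, simply connected Lie group $G=G_1\times\cdots\times G_m$ with simple factors $G_i$, $\Pi$ is the coroot lattice, and $\cdot$ is the basic inner product on each factor.) Put $T=\mathfrak t/\Pi$ with quotient map $\exp\colon\mathfrak t\to T$, and let $T_{\mathbb C}=\mathfrak t_{\mathbb C}/\Pi$, $\mathfrak t_{\mathbb C}=\mathfrak t\otimes\mathbb C$. Let $\Lambda=\{\lambda\in\mathfrak t:\lambda\cdot\Pi\subset\mathbb Z\}$; for $\lambda\in\Lambda$ write $u^\lambda=e^{2\pi i\lambda\cdot\xi}$ for $u=\exp\xi$, and let $\mathbb CR(T)=\mathbb C[\Lambda]$ be the algebra of finite linear combinations of the functions $u^\lambda$. Let $\ell=(\ell_1,\dots,\ell_m)$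 be a tuple of positive integers, acting on $\mathfrak t$ as multiplication by $\ell_i$ on $\mathfrak t_i$, and let $T_\ell=\ell^{-1}\Lambda/\Pi\subset T$, which is a finite subgroup. Functions in $\mathbb CR(T)$ are regarded as distributions on $T$ by integration against the invariant measure $du$ of total mass $1$. A jet at $g\in T$ is an expression $g_t=g\exp(g_t^+)$ with $g_t^+\in t\,\mathfrak t_{\mathbb C}[[t]]$, i.e. an $\infty$-jet of curves in $T_{\mathbb C}$ based at $g$. For $F\in C^\infty(T)$, $F(g_t)\in\mathbb C[[t]]$ is obtained by substituting $g_t^+$ into the Taylor series of $\xi\mapsto F(g\exp\xi)$ at $0$; this defines $\delta_{g_t}\colon F\mapsto F(g_t)$ in $\mathcal D'(T)[[t]]$. In the same way $f_t(g_t)=\sum_j t^jf_j(g_t)$ for $f_t=\sum_jt^jf_j\in\mathbb CR(T)[[t]]$. **Theorem (formal Poisson summation).** Let $v_t\in\mathfrak t_{\mathbb C}\otimes\mathbb CR(T)[[t]]$ and $\Phi_t(u)=u\exp(t\ell^{-1}v_t(u))$, so that $\Phi_t(u)^{\lambda}=u^{\lambda}\exp\big(2\pi i\,t\,\lambda\cdot\ell^{-1}v_t(u)\big)\in\mathbb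 CR(T)[[t]]$ for $\lambda\in\Lambda$, and $\Phi_t(g_t)=g\exp\big(g_t^++t\ell^{-1}v_t(g_t)\big)$ for a jet $g_t$ at $g$. Let $dv_t\in\mathrm{End}(\mathfrak t_{\mathbb C})\otimes\mathbb CR(T)[[t]]$ be the differential of $\xi\mapsto v_t(\exp\xi)$. For every $g\in T$ there is a unique jet $g_t$ with $\Phi_t(g_t)=g$, the constant jet. For $g\in T_\ell$ and this $g_t$, the series $\det(1+t\ell^{-1}dv_t)$ evaluated at $g_t$ lies in $1+t\,\mathbb C[[t]]$, and $$\sum_{\eta\in\Pi}\Phi_t(u)^{\ell\eta}=\frac1{|T_\ell|}\sum_{g\in T_\ell}\frac{\delta_{g_t}(u)}{\det\big(1+t\ell^{-1}dv_t(g_t)\big)}\qquad\text{in }\mathcal D'(T)[[t]],$$ where the coefficient of each $t^n$ on the left is a series over $\eta\in\Pi$ that converges unconditionally in $\mathcal D'(T)$, i.e. after pairing with any $f\in C^\infty(T)$. -/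

import Mathlib

set_option linter.unusedSectionVars false

open scoped TensorProduct PowerSeries InnerProductSpace ContDiff

noncomputable section

namespace FormalTorus

section Torus

variable {V : Type*} [NormedAddCommGroup V] [InnerProductSpace ℝ V] [FiniteDimensional ℝ V]

/-- The torus `T = 𝔱 / Π`, written additively; the exponential map `𝔱 → T` is `Π.mkQ`. -/
abbrev Torus (P : Submodule ℤ V) : Type _ := V ⧸ P

/-- A chosen logarithm of a point of `T`. Everything below is independent of this choice. -/
def logRep (P : Submodule ℤ V) (g : Torus P) : V := Function.surjInv P.mkQ_surjective g

lemma exists_logRep_mk (P : Submodule ℤ V) (x : V) : ∃ η ∈ P, logRep P (P.mkQ x) = x + η := by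
  refine ⟨logRep P (P.mkQ x) - x, ?_, by abel⟩
  have h : P.mkQ (logRep P (P.mkQ x)) = P.mkQ x := Function.surjInv_eq P.mkQ_surjective _
  rwa [← sub_eq_zero, ← map_sub, Submodule.mkQ_apply, Submodule.Quotient.mk_eq_zero] at h

/-- The weight lattice `Λ = Hom(Π, ℤ)`, as a lattice in `𝔱` through the inner product. -/
abbrev weightLattice (P : Submodule ℤ V) : Submodule ℤ V :=
  LinearMap.BilinForm.dualSubmodule (innerₗ V) P

lemma mem_weightLattice {P : Submodule ℤ V} {x : V} :
    x ∈ weightLattice P ↔ ∀ η ∈ P, ∃ n : ℤ, (n : ℝ) = ⟪x, η⟫_ℝ := by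
  simp [weightLattice, LinearMap.BilinForm.mem_dualSubmodule, Submodule.mem_one]

/-- The character `u ↦ u ^ lam` of `T`, i.e. `exp ξ ↦ e ^ (2 π i lam · ξ)`. -/
def character (P : Submodule ℤ V) (lam : weightLattice P) (u : Torus P) : ℂ :=
  Complex.exp (2 * Real.pi * Complex.I * ((⟪(lam : V), logRep P u⟫_ℝ : ℝ) : ℂ))

lemma character_mk (P : Submodule ℤ V) (lam : weightLattice P) (x : V) :
    character P lam (P.mkQ x) =
      Complex.exp (2 * Real.pi * Complex.I * ((⟪(lam : V), x⟫_ℝ : ℝ) : ℂ)) := by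
  obtain ⟨η, hη, h⟩ := exists_logRep_mk P x
  obtain ⟨n, hn⟩ := mem_weightLattice.1 lam.2 η hη
  rw [character, h, inner_add_right, ← hn]
  push_cast
  rw [mul_add, Complex.exp_add, mul_comm _ (n : ℂ), Complex.exp_int_mul_two_pi_mul_I, mul_one]

/-- The complexified representation ring `ℂ R(T) = ℂ[Λ]`; the basis element `single lam 1` is the
function `u ↦ u ^ lam`. -/
abbrev RepRing (P : Submodule ℤ V) : Type _ := AddMonoidAlgebra ℂ (weightLattice P)

/-- The `ℂ`-linear map on `ℂ[Λ]` with prescribed values on the characters. -/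
def linExt (P : Submodule ℤ V) {M : Type*} [AddCommGroup M] [Module ℂ M]
    (h : weightLattice P → M) : RepRing P →ₗ[ℂ] M where
  toFun p := Finsupp.linearCombination ℂ h p.coeff
  map_add' p q := by simp
  map_smul' c p := by simp

/-- The value at `u ∈ T` of an element of `ℂ R(T)`. -/
def repEval (P : Submodule ℤ V) (p : RepRing P) (u : Torus P) : ℂ :=
  linExt P (fun lam => character P lam u) p

lemma continuous_repEval (P : Submodule ℤ V) (p : RepRing P) :
    Continuous fun x : V => repEval P p (P.mkQ x) := by
  simp only [repEval, linExt, LinearMap.coe_mk, AddHom.coe_mk, Finsupp.linearCombination_apply,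
    Finsupp.sum, character_mk]
  fun_prop

/-! ### Smooth functions and distributions on the torus -/

/-- `C^∞(T)`. -/
def SmoothFn (P : Submodule ℤ V) : Submodule ℂ (Torus P → ℂ) where
  carrier := {f | ContDiff ℝ ∞ fun x : V => f (P.mkQ x)}
  add_mem' {f g} hf hg := by
    have hf : ContDiff ℝ ∞ fun x : V => f (P.mkQ x) := hf
    have hg : ContDiff ℝ ∞ fun x : V => g (P.mkQ x) := hg
    exact hf.add hg
  zero_mem' := (contDiff_const : ContDiff ℝ ∞ fun _ : V => (0 : ℂ))
  smul_mem' c f hf := by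
    have hf : ContDiff ℝ ∞ fun x : V => f (P.mkQ x) := hf
    exact hf.const_smul c

/-- The pullback of a smooth function on `T` to `𝔱`. -/
def pull {P : Submodule ℤ V} (f : SmoothFn P) (x : V) : ℂ := f.1 (P.mkQ x)

lemma contDiff_pull {P : Submodule ℤ V} (f : SmoothFn P) : ContDiff ℝ ∞ (pull f) := f.2

lemma pull_add {P : Submodule ℤ V} (f g : SmoothFn P) :
    pull (f + g) = (pull f) + (pull g) := rfl

lemma pull_smul {P : Submodule ℤ V} (c : ℂ) (f : SmoothFn P) :
    pull (c • f) = c • pull f := rfl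

/-- `𝒟'(T)`: the linear functionals on `C^∞(T)` that are continuous for the `C^∞` topology, i.e.
bounded by a multiple of the supremum over `T` of finitely many derivatives. -/
def TorusDist (P : Submodule ℤ V) : Submodule ℂ (SmoothFn P →ₗ[ℂ] ℂ) where
  carrier := {D | ∃ (C : ℝ) (N : ℕ), ∀ (f : SmoothFn P) (M : ℝ),
    (∀ j ≤ N, ∀ x : V, ‖iteratedFDeriv ℝ j (pull f) x‖ ≤ M) → ‖D f‖ ≤ C * M}
  add_mem' := by
    rintro D D' ⟨C, N, h⟩ ⟨C', N', h'⟩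
    refine ⟨C + C', max N N', fun f M hM => ?_⟩
    have h1 := h f M fun j hj => hM j (hj.trans (le_max_left _ _))
    have h2 := h' f M fun j hj => hM j (hj.trans (le_max_right _ _))
    calc ‖D f + D' f‖ ≤ ‖D f‖ + ‖D' f‖ := norm_add_le _ _
      _ ≤ (C + C') * M := by linarith
  zero_mem' := ⟨0, 0, fun f M _ => by simp⟩
  smul_mem' := by
    rintro c D ⟨C, N, h⟩
    refine ⟨‖c‖ * C, N, fun f M hM => ?_⟩
    have h1 := h f M hM
    calc ‖c • D f‖ = ‖c‖ * ‖D f‖ := norm_smul _ _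
      _ ≤ ‖c‖ * (C * M) := by gcongr
      _ = ‖c‖ * C * M := by ring

/-- The topology of `𝒟'(T)`: convergence against every test function. -/
instance (P : Submodule ℤ V) : TopologicalSpace (TorusDist P) :=
  TopologicalSpace.induced (fun (D : TorusDist P) (f : SmoothFn P) => D.1 f) inferInstance

/-- `𝒟'(T)[[t]]`: formal series `∑ tⁿ Dₙ`, with the topology of coefficientwise convergence. -/
abbrev DistSeries (P : Submodule ℤ V) : Type _ := ℕ → TorusDist P

/-- The product of a scalar series in `ℂ[[t]]` with a formal series of distributions. -/
def seriesMul {P : Submodule ℤ V} (a : ℂ⟦X⟧) (D : DistSeries P) : DistSeries P := fun n =>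
  ∑ p ∈ Finset.HasAntidiagonal.antidiagonal n, PowerSeries.coeff p.1 a • D p.2

section Integral

variable (P : Submodule ℤ V) [DiscreteTopology P] [IsZLattice ℝ P]

/-- A `ℤ`-basis of the lattice `Π`. -/
def latticeBasis : Module.Basis (Fin (Module.finrank ℤ P)) ℤ P :=
  haveI := ZLattice.module_free ℝ P
  haveI := ZLattice.module_finite ℝ P
  Module.finBasis ℤ P

/-- The integral `∫_T h(u) du` for the invariant measure of total mass one (Lebesgue measure on `𝔱`
normalized by `Π`), computed in the coordinates given by a `ℤ`-basis of `Π`. -/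
def torusIntegral (h : Torus P → ℂ) : ℂ :=
  ∫ s in Set.Icc (0 : Fin (Module.finrank ℤ P) → ℝ) 1,
    h (P.mkQ (∑ i, s i • (latticeBasis P i : V)))

lemma integrableOn_torus (h : Torus P → ℂ) (hh : Continuous fun x : V => h (P.mkQ x)) :
    MeasureTheory.IntegrableOn (fun s : Fin (Module.finrank ℤ P) → ℝ =>
      h (P.mkQ (∑ i, s i • (latticeBasis P i : V)))) (Set.Icc 0 1) := by
  apply Continuous.integrableOn_Icc
  exact hh.comp (by fun_prop : Continuous fun s : Fin (Module.finrank ℤ P) → ℝ =>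
    ∑ i, s i • (latticeBasis P i : V))

lemma continuous_mul_repEval (f : SmoothFn P) (p : RepRing P) :
    Continuous fun x : V => f.1 (P.mkQ x) * repEval P p (P.mkQ x) :=
  (contDiff_pull f).continuous.mul (continuous_repEval P p)

/-- An element `p` of `ℂ R(T)` as a distribution: `f ↦ ∫_T f(u) p(u) du`. -/
def repDist (p : RepRing P) : TorusDist P where
  val :=
    { toFun := fun f => torusIntegral P fun u => f.1 u * repEval P p u
      map_add' := fun f g => by
        refine Eq.trans ?_ (MeasureTheory.integral_add
          (integrableOn_torus P (fun u => f.1 u * repEval P p u) (continuous_mul_repEval P f p))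
          (integrableOn_torus P (fun u => g.1 u * repEval P p u) (continuous_mul_repEval P g p)))
        refine MeasureTheory.integral_congr_ae (Filter.Eventually.of_forall fun s => ?_)
        exact add_mul _ _ _
      map_smul' := fun c f => by
        rw [torusIntegral, torusIntegral, RingHom.id_apply, smul_eq_mul,
          ← MeasureTheory.integral_const_mul]
        refine MeasureTheory.integral_congr_ae (Filter.Eventually.of_forall fun s => ?_)
        exact mul_assoc _ _ _ }
  property := by
    refine ⟨∫ s in Set.Icc (0 : Fin (Module.finrank ℤ P) → ℝ) 1,
      ‖repEval P p (P.mkQ (∑ i, s i • (latticeBasis P i : V)))‖, 0, fun f M hM => ?_⟩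
    have hb : ∀ u, ‖f.1 u‖ ≤ M := fun u => by
      obtain ⟨x, rfl⟩ := P.mkQ_surjective u
      simpa [pull] using hM 0 le_rfl x
    rw [← MeasureTheory.integral_mul_const]
    refine MeasureTheory.norm_integral_le_of_norm_le
      ((integrableOn_torus P _ (continuous_repEval P p)).norm.mul_const M)
      (Filter.Eventually.of_forall fun s => ?_)
    rw [norm_mul, mul_comm]
    exact mul_le_mul_of_nonneg_left (hb _) (norm_nonneg _)

/-- A formal series in `ℂ R(T)[[t]]` as a formal series of distributions. -/
def repSeriesDist (a : (RepRing P)⟦X⟧) : DistSeries P := fun n => repDist P (PowerSeries.coeff n a)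

end Integral

/-! ### Jets in the complexified torus -/

/-- `exp(a)` for a formal series `a` without constant term. -/
def formalExp {B : Type*} [CommRing B] [Algebra ℂ B] (a : B⟦X⟧) : B⟦X⟧ :=
  (PowerSeries.exp ℂ).subst a

/-- The pairing `x · w` of `x ∈ 𝔱` with `w ∈ B ⊗ 𝔱`, extended `B`-linearly in `w`. -/
def pairing (B : Type*) [CommRing B] [Algebra ℝ B] (x : V) : B ⊗[ℝ] V →ₗ[B] B :=
  ((Algebra.linearMap ℝ B).comp (innerₗ V x)).liftBaseChange B

/-- An `∞`-jet of curves in `T_ℂ` whose base point `g` lies in `T`. It is recorded by its unique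
factorization `g_t = g exp(g_t⁺)` with `g_t⁺ ∈ t 𝔱_ℂ[[t]]`, where `𝔱_ℂ[[t]] = ℂ[[t]] ⊗ 𝔱`. -/
@[ext]
structure Jet (P : Submodule ℤ V) where
  base : Torus P
  log : ℂ⟦X⟧ ⊗[ℝ] V
  log_mem : ∃ w : ℂ⟦X⟧ ⊗[ℝ] V, log = (PowerSeries.X : ℂ⟦X⟧) • w

/-- The constant jet at `g`. -/
def Jet.const {P : Submodule ℤ V} (g : Torus P) : Jet P where
  base := g
  log := 0
  log_mem := ⟨0, by simp⟩

/-- The value `g_t ^ lam = g ^ lam exp(2 π i lam · g_t⁺) ∈ ℂ[[t]]` of a character at a jet. -/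
def Jet.character {P : Submodule ℤ V} (γ : Jet P) (lam : weightLattice P) : ℂ⟦X⟧ :=
  FormalTorus.character P lam γ.base •
    formalExp ((2 * Real.pi * Complex.I : ℂ) • pairing ℂ⟦X⟧ (lam : V) γ.log)

/-- The value `f_t(g_t) = ∑ t^j f_j(g_t) ∈ ℂ[[t]]` at a jet of `f_t = ∑ t^j f_j ∈ ℂ R(T)[[t]]`. -/
def Jet.eval {P : Submodule ℤ V} (γ : Jet P) : (RepRing P)⟦X⟧ →ₗ[ℂ] ℂ⟦X⟧ where
  toFun f := PowerSeries.mk fun n => ∑ p ∈ Finset.HasAntidiagonal.antidiagonal n,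
    PowerSeries.coeff p.2 (linExt P γ.character (PowerSeries.coeff p.1 f))
  map_add' f g := by
    ext n
    simp [Finset.sum_add_distrib]
  map_smul' c f := by
    ext n
    simp [Finset.mul_sum]

/-- The coefficient of `tⁿ` in `F(g_t)`, for `F ∈ C^∞(T)`: the series `g_t⁺` is substituted into the
Taylor series `∑ₖ (1/k!) DᵏF(g)(ξ, …, ξ)` of `F` at `g`, where `DᵏF(g)` is extended to complex
formal arguments by multilinearity. As `g_t⁺` has no constant term, only `k ≤ n` contributes. -/
def Jet.taylorCoeff {P : Submodule ℤ V} (γ : Jet P) (n : ℕ) (F : SmoothFn P) : ℂ :=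
  ∑ k ∈ Finset.range (n + 1), ((k.factorial : ℂ))⁻¹ *
    ∑ i : Fin k → Fin (Module.finrank ℝ V),
      iteratedFDeriv ℝ k (pull F) (logRep P γ.base) (fun j => stdOrthonormalBasis ℝ V (i j)) *
        PowerSeries.coeff n (∏ j, pairing ℂ⟦X⟧ (stdOrthonormalBasis ℝ V (i j)) γ.log)

/-- The formal series of distributions `δ_{g_t} : F ↦ F(g_t)`. -/
def Jet.delta {P : Submodule ℤ V} (γ : Jet P) : DistSeries P := fun n =>
  { val :=
      { toFun := fun F => γ.taylorCoeff n F
        map_add' := fun F G => by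
          have h : ∀ k : ℕ, iteratedFDeriv ℝ k (pull (F + G)) (logRep P γ.base) =
              iteratedFDeriv ℝ k (pull F) (logRep P γ.base) +
                iteratedFDeriv ℝ k (pull G) (logRep P γ.base) := fun k => by
            rw [pull_add]
            exact iteratedFDeriv_add_apply
              ((contDiff_pull F).of_le (by exact_mod_cast le_top)).contDiffAt
              ((contDiff_pull G).of_le (by exact_mod_cast le_top)).contDiffAt
          simp only [Jet.taylorCoeff, h, add_apply, add_mul,
            Finset.sum_add_distrib, mul_add]
        map_smul' := fun c F => by
          have h : ∀ k : ℕ, iteratedFDeriv ℝ k (pull (c • F)) (logRep P γ.base) =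
              c • iteratedFDeriv ℝ k (pull F) (logRep P γ.base) := fun k => by
            rw [pull_smul]
            exact iteratedFDeriv_const_smul_apply
              ((contDiff_pull F).of_le (by exact_mod_cast le_top)).contDiffAt
          simp only [Jet.taylorCoeff, h, smul_apply, smul_eq_mul,
            RingHom.id_apply, Finset.mul_sum]
          refine Finset.sum_congr rfl fun k _ => Finset.sum_congr rfl fun i _ => ?_
          ring }
    property := by
      refine ⟨∑ k ∈ Finset.range (n + 1), ‖((k.factorial : ℂ))⁻¹‖ *
        ∑ i : Fin k → Fin (Module.finrank ℝ V),
          ‖PowerSeries.coeff n (∏ j, pairing ℂ⟦X⟧ (stdOrthonormalBasis ℝ V (i j)) γ.log)‖,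
        n, fun F M hM => ?_⟩
      simp only [LinearMap.coe_mk, AddHom.coe_mk, Jet.taylorCoeff, Finset.sum_mul]
      refine (norm_sum_le _ _).trans (Finset.sum_le_sum fun k hk => ?_)
      rw [norm_mul, mul_assoc]
      refine mul_le_mul_of_nonneg_left ?_ (norm_nonneg _)
      rw [Finset.sum_mul]
      refine (norm_sum_le _ _).trans (Finset.sum_le_sum fun i _ => ?_)
      rw [norm_mul, mul_comm]
      refine mul_le_mul_of_nonneg_left ?_ (norm_nonneg _)
      refine (ContinuousMultilinearMap.le_opNorm _ _).trans ?_
      simpa using hM k (by simpa [Nat.lt_succ_iff] using hk) (logRep P γ.base) }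

/-! ### The formal change of variables -/

/-- Formal series of vector fields `v_t ∈ 𝔱_ℂ ⊗ ℂ R(T)[[t]]`. -/
abbrev VectorField (P : Submodule ℤ V) : Type _ := (RepRing P)⟦X⟧ ⊗[ℝ] V

/-- The vector `v_t(g_t) ∈ 𝔱_ℂ[[t]]`. -/
def VectorField.eval {P : Submodule ℤ V} (v : VectorField P) (γ : Jet P) : ℂ⟦X⟧ ⊗[ℝ] V :=
  LinearMap.rTensor V (γ.eval.restrictScalars ℝ) v

/-- The derivative `∂_ξ f` of `f ∈ ℂ R(T)` in the direction `ξ`: `∂_ξ u^lam = 2 π i (lam · ξ) u^lam`.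
-/
def repDeriv {P : Submodule ℤ V} (ξ : V) : RepRing P →ₗ[ℂ] RepRing P :=
  linExt P fun lam => AddMonoidAlgebra.single lam
    (2 * Real.pi * Complex.I * ((⟪(lam : V), ξ⟫_ℝ : ℝ) : ℂ))

lemma repDeriv_add {P : Submodule ℤ V} (ξ ξ' : V) (p : RepRing P) :
    repDeriv (ξ + ξ') p = repDeriv ξ p + repDeriv ξ' p := by
  simp only [repDeriv, linExt, LinearMap.coe_mk, AddHom.coe_mk, Finsupp.linearCombination_apply,
    Finsupp.sum, inner_add_right, Complex.ofReal_add, mul_add, AddMonoidAlgebra.single_add,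
    smul_add, Finset.sum_add_distrib]

lemma repDeriv_smul {P : Submodule ℤ V} (c : ℝ) (ξ : V) (p : RepRing P) :
    repDeriv (c • ξ) p = c • repDeriv ξ p := by
  simp only [repDeriv, linExt, LinearMap.coe_mk, AddHom.coe_mk, Finsupp.linearCombination_apply,
    Finsupp.sum, real_inner_smul_right, Complex.ofReal_mul, Finset.smul_sum,
    AddMonoidAlgebra.smul_single]
  refine Finset.sum_congr rfl fun lam _ => ?_
  congr 1
  simp only [smul_eq_mul, Complex.real_smul]
  ring

/-- The derivative `(ξ, f_t) ↦ ∂_ξ f_t`, coefficient by coefficient in `t`. -/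
def seriesDeriv (P : Submodule ℤ V) : V →ₗ[ℝ] (RepRing P)⟦X⟧ →ₗ[ℝ] (RepRing P)⟦X⟧ :=
  LinearMap.mk₂ ℝ (fun ξ f => PowerSeries.mk fun n => repDeriv ξ (PowerSeries.coeff n f))
    (fun ξ ξ' f => by ext1 n; simp [repDeriv_add])
    (fun c ξ f => by ext1 n; simp [repDeriv_smul])
    (fun ξ f g => by ext1 n; simp)
    (fun c ξ f => by
      ext1 n
      simp only [PowerSeries.coeff_mk, PowerSeries.coeff_smul]
      exact LinearMap.map_smul_of_tower _ c _)

/-- The differential `dv_t ∈ End(𝔱_ℂ) ⊗ ℂ R(T)[[t]]`, `ξ ↦ ∂_ξ v_t`, as an endomorphism of the free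
`ℂ R(T)[[t]]`-module `ℂ R(T)[[t]] ⊗ 𝔱`. -/
def VectorField.differential {P : Submodule ℤ V} (v : VectorField P) :
    (RepRing P)⟦X⟧ ⊗[ℝ] V →ₗ[(RepRing P)⟦X⟧] (RepRing P)⟦X⟧ ⊗[ℝ] V :=
  (((LinearMap.rTensorHom V).comp (seriesDeriv P)).flip v).liftBaseChange (RepRing P)⟦X⟧

/-! ### The level -/

variable {m : ℕ}

/-- For a decomposition `𝔱 = 𝔱₁ ⊕ ⋯ ⊕ 𝔱ₘ` into orthogonal subspaces, the operator that multiplies by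
`c i` on the summand `𝔱ᵢ`. -/
def scaleMap (S : Fin m → Submodule ℝ V) (c : Fin m → ℝ) : V →ₗ[ℝ] V :=
  ∑ i, c i • ((S i).starProjection : V →ₗ[ℝ] V)

/-- The level `ℓ = (ℓ₁, …, ℓₘ)` as an operator on `𝔱`. -/
def level (S : Fin m → Submodule ℝ V) (l : Fin m → ℕ) : V →ₗ[ℝ] V := scaleMap S fun i => (l i : ℝ)

/-- The operator `ℓ⁻¹` on `𝔱`. -/
def levelInv (S : Fin m → Submodule ℝ V) (l : Fin m → ℕ) : V →ₗ[ℝ] V :=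
  scaleMap S fun i => (l i : ℝ)⁻¹

/-- The data of a maximal torus of a product of simple factors, as far as lattices are concerned:
`𝔱` is the orthogonal direct sum of the subspaces `S i`, the lattice `Π` is the direct sum of its
intersections with them, and the inner product takes integer values on `Π`. -/
structure IsIntegralDecomposition (P : Submodule ℤ V) (S : Fin m → Submodule ℝ V) : Prop where
  internal : DirectSum.IsInternal S
  orthogonal : ∀ i j, i ≠ j → S i ⟂ S j
  split : ∀ i, ∀ η ∈ P, (S i).starProjection η ∈ P
  integral : ∀ η ∈ P, ∀ η' ∈ P, ∃ n : ℤ, (n : ℝ) = ⟪η, η'⟫_ℝ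

lemma IsIntegralDecomposition.level_mem {P : Submodule ℤ V} {S : Fin m → Submodule ℝ V}
    (h : IsIntegralDecomposition P S) (l : Fin m → ℕ) {η : V} (hη : η ∈ P) :
    level S l η ∈ weightLattice P := by
  have hP : level S l η ∈ P := by
    simp only [level, scaleMap, LinearMap.sum_apply, LinearMap.smul_apply]
    refine P.sum_mem fun i _ => ?_
    have := P.smul_mem (l i : ℤ) (h.split i η hη)
    simpa [Nat.cast_smul_eq_nsmul] using this
  exact mem_weightLattice.2 fun η' hη' => h.integral _ hP _ hη'

/-- The weight `ℓ η ∈ Λ` for `η ∈ Π`. -/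
def levelWeight {P : Submodule ℤ V} {S : Fin m → Submodule ℝ V}
    (h : IsIntegralDecomposition P S) (l : Fin m → ℕ) (η : P) : weightLattice P :=
  ⟨level S l η, h.level_mem l η.2⟩

/-- The subgroup `T_ℓ = ℓ⁻¹ Λ / Π` of `T = 𝔱 / Π`. -/
def levelSubgroup (P : Submodule ℤ V) (S : Fin m → Submodule ℝ V) (l : Fin m → ℕ) :
    Submodule ℤ (Torus P) :=
  ((weightLattice P).comap ((level S l).restrictScalars ℤ)).map P.mkQ

/-- The rescaled vector field `ℓ⁻¹ v_t`. -/
def rescaled {P : Submodule ℤ V} (S : Fin m → Submodule ℝ V) (l : Fin m → ℕ) (v : VectorField P) :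
    VectorField P :=
  (levelInv S l).baseChange (RepRing P)⟦X⟧ v

/-- For `Φ_t(u) = u exp(t ℓ⁻¹ v_t(u))`, the series `Φ_t(u) ^ lam = u ^ lam exp(2 π i t lam · ℓ⁻¹ v_t(u))`
in `ℂ R(T)[[t]]`. -/
def phiCharacter {P : Submodule ℤ V} (S : Fin m → Submodule ℝ V) (l : Fin m → ℕ)
    (v : VectorField P) (lam : weightLattice P) : (RepRing P)⟦X⟧ :=
  PowerSeries.C (AddMonoidAlgebra.single lam 1) *
    formalExp ((2 * Real.pi * Complex.I : ℂ) •
      (PowerSeries.X * pairing (RepRing P)⟦X⟧ (lam : V) (rescaled S l v)))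

/-- The jet `Φ_t(g_t) = g_t exp(t ℓ⁻¹ v_t(g_t))`. -/
def phiJet {P : Submodule ℤ V} (S : Fin m → Submodule ℝ V) (l : Fin m → ℕ)
    (v : VectorField P) (γ : Jet P) : Jet P where
  base := γ.base
  log := γ.log + (PowerSeries.X : ℂ⟦X⟧) • (rescaled S l v).eval γ
  log_mem := by
    obtain ⟨w, hw⟩ := γ.log_mem
    exact ⟨w + (rescaled S l v).eval γ, by rw [hw, smul_add]⟩

/-- The determinant `det(1 + t ℓ⁻¹ dv_t) ∈ ℂ R(T)[[t]]`. -/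
def jacobianDet {P : Submodule ℤ V} (S : Fin m → Submodule ℝ V) (l : Fin m → ℕ)
    (v : VectorField P) : (RepRing P)⟦X⟧ :=
  LinearMap.det (1 + (PowerSeries.X : (RepRing P)⟦X⟧) •
    ((levelInv S l).baseChange (RepRing P)⟦X⟧).comp v.differential)

end Torus

end FormalTorus

end

open FormalTorus

/-! Pairing with a test function `f` and reading off the coefficient of `t ^ n` turns the formula
into a statement about numbers, which is proved first for characters and then for all smooth
functions.

For characters, multiplication by the left-hand side followed by integration over `T`, and the
right-hand side, are both functionals on `ℂ R(T)[[t]]` that commute with `t`. They are compared on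
the series `Φ_t ^ mu * det(dΦ_t)`. On the left the term of `η` becomes `∫ Φ_t ^ (mu + ℓ η) det(dΦ_t)
du`, which by a formal change of variables (`constTerm_phiCharacter_mul_jacobianDet`) equals `∫ u ^
(mu + ℓ η) du`; so the sum is `1` if `mu ∈ ℓ Π` and `0` otherwise. On the right the determinant
cancels, and `Φ_t(g_t) = g` leaves the average of `g ^ mu` over `T_ℓ`. Orthogonality of characters
(`sum_character_levelSubgroup`) gives the same value, since the annihilator of `T_ℓ` is `ℓ Π`. The
test series have leading term `u ^ mu`, so they are triangular with respect to the characters, and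
induction on the power of `t` passes from them to all of `ℂ R(T)` (`hasSum_coeff_of_leading`).

The change of variables is algebraic. Integration over `T` takes the constant Fourier coefficient
and therefore kills derivatives; by the Piola identity (`sum_derivation_adjugate`) the difference of
the two integrands is a divergence.

For a smooth `f`, Fourier coefficients decay faster than any power of the weight, whereas the
coefficient of `t ^ n` in `Φ_t ^ (ℓ η)` grows at most polynomially in `η`. The double series over `Π
× Λ` hence converges absolutely (`summable_fourierCoeff_mul_coeff_phiCharacter`), and interchanging
the two sums reduces the claim to characters. On the other side `F(g_t)` involves finitely many
derivatives, which may be computed termwise from the Fourier series.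

The jets `g_t` come from a contraction argument in the `t`-adic topology. -/

noncomputable section

namespace FormalTorus

/-! ### The exponential of a formal series without constant term -/

section FormalExp

open PowerSeries

variable {B : Type*} [CommRing B]

lemma coeff_pow_eq_zero_of_constantCoeff {a : B⟦X⟧} (ha : constantCoeff a = 0) {n k : ℕ}
    (h : n < k) : coeff n (a ^ k) = 0 :=
  X_pow_dvd_iff.1 (pow_dvd_pow_of_dvd (X_dvd_iff.2 ha) k) n h

/-- Separatedness of the `X`-adic topology: it allows identities of series to be checked modulo
every `X ^ N`, on finite truncations. -/
lemma eq_of_X_pow_dvd_sub {f g : B⟦X⟧} (h : ∀ N, (X : B⟦X⟧) ^ N ∣ f - g) : f = g := by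
  ext n
  simpa [sub_eq_zero] using X_pow_dvd_iff.1 (h (n + 1)) n n.lt_succ_self

variable [Algebra ℂ B]

/-- As `X ^ k` divides `a ^ k`, each coefficient is a finite sum. The cutoff `N` is left free so
that one truncation serves all degrees below it. -/
lemma coeff_formalExp {a : B⟦X⟧} (ha : constantCoeff a = 0) {n N : ℕ} (h : n < N) :
    coeff n (formalExp a) =
      ∑ k ∈ Finset.range N, ((k.factorial : ℂ))⁻¹ • coeff n (a ^ k) := by
  rw [formalExp, coeff_subst' (HasSubst.of_constantCoeff_zero' ha),
    finsum_eq_sum_of_support_subset (s := Finset.range N)]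
  · refine Finset.sum_congr rfl fun k _ => ?_
    simp [coeff_exp]
  · intro k hk
    by_contra hkN
    simp only [Finset.coe_range, Set.mem_Iio, not_lt] at hkN
    exact hk (by simp [coeff_pow_eq_zero_of_constantCoeff ha (h.trans_le hkN)])

lemma X_pow_dvd_formalExp_sub {a : B⟦X⟧} (ha : constantCoeff a = 0) (N : ℕ) :
    (X : B⟦X⟧) ^ N ∣ formalExp a - ∑ k ∈ Finset.range N, ((k.factorial : ℂ))⁻¹ • a ^ k := by
  refine X_pow_dvd_iff.2 fun n hn => ?_
  simp [coeff_formalExp ha hn, map_sum]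

lemma constantCoeff_formalExp {a : B⟦X⟧} (ha : constantCoeff a = 0) :
    constantCoeff (formalExp a) = 1 := by
  rw [← coeff_zero_eq_constantCoeff_apply, coeff_formalExp ha zero_lt_one]
  simp

lemma formalExp_zero : formalExp (0 : B⟦X⟧) = 1 := by
  ext n
  rw [coeff_formalExp (map_zero _) n.lt_succ_self, Finset.sum_range_succ']
  simp

/-- Fixing `X` already makes an algebra homomorphism preserve divisibility by `X ^ N`, so no
separate continuity assumption is needed. -/
lemma map_formalExp {B' : Type*} [CommRing B'] [Algebra ℂ B'] (φ : B⟦X⟧ →ₐ[ℂ] B'⟦X⟧)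
    (hφ : φ X = X) {a : B⟦X⟧} (ha : constantCoeff a = 0) : φ (formalExp a) = formalExp (φ a) := by
  have ha' : constantCoeff (φ a) = 0 := by
    obtain ⟨b, rfl⟩ := X_dvd_iff.2 ha
    simp [hφ]
  refine eq_of_X_pow_dvd_sub fun N => ?_
  have h1 := map_dvd φ (X_pow_dvd_formalExp_sub ha N)
  have h2 := X_pow_dvd_formalExp_sub ha' N
  simp only [map_pow, hφ, map_sub, map_sum, map_smul] at h1
  simpa using dvd_sub h1 h2

/-- The derivation may lower the `X`-adic order by one. This covers `d/dt` as well as derivatives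
along `T`, which act on coefficients. -/
lemma derivation_formalExp (D : Derivation ℤ B⟦X⟧ B⟦X⟧)
    (hD : ∀ (f : B⟦X⟧) n, (X : B⟦X⟧) ^ (n + 1) ∣ f → (X : B⟦X⟧) ^ n ∣ D f)
    {a : B⟦X⟧} (ha : constantCoeff a = 0) : D (formalExp a) = formalExp a * D a := by
  refine eq_of_X_pow_dvd_sub fun N => ?_
  have h1 := hD _ _ (X_pow_dvd_formalExp_sub ha (N + 1))
  have h2 := (X_pow_dvd_formalExp_sub ha N).mul_right (D a)
  have h3 : D (∑ k ∈ Finset.range (N + 1), ((k.factorial : ℂ))⁻¹ • a ^ k) =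
      (∑ k ∈ Finset.range N, ((k.factorial : ℂ))⁻¹ • a ^ k) * D a := by
    rw [map_sum, Finset.sum_range_succ', Finset.sum_mul]
    -- `D` is only assumed `ℤ`-linear, but an additive map commutes with division by natural
    -- numbers.
    have : ∀ (k : ℕ) (f : B⟦X⟧), D (((k.factorial : ℂ))⁻¹ • f) = ((k.factorial : ℂ))⁻¹ • D f :=
      fun k f => map_inv_natCast_smul D ℂ ℂ _ f
    simp only [this, Derivation.leibniz_pow]
    simp only [zero_smul, smul_zero, add_zero]
    refine Finset.sum_congr rfl fun k _ => ?_
    rw [← Nat.cast_smul_eq_nsmul ℂ, smul_smul, Nat.add_sub_cancel, smul_eq_mul, smul_mul_assoc,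
      Nat.factorial_succ]
    congr 1
    have := Nat.cast_ne_zero (R := ℂ).2 k.factorial_ne_zero
    have := Nat.cast_ne_zero (R := ℂ).2 k.succ_ne_zero
    push_cast at *
    field_simp
  rw [map_sub, h3] at h1
  have := dvd_sub h1 h2
  rwa [show ∀ x y z w : B⟦X⟧, x - y * w - (z - y) * w = x - z * w by intros; ring] at this

/-- The difference `z` of the two sides solves the linear equation `z' = z (a + b)'` with zero
initial value, and such a solution vanishes coefficient by coefficient. -/
lemma formalExp_add {a b : B⟦X⟧} (ha : constantCoeff a = 0) (hb : constantCoeff b = 0) :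
    formalExp (a + b) = formalExp a * formalExp b := by
  let D : Derivation ℤ B⟦X⟧ B⟦X⟧ := (PowerSeries.derivative B).restrictScalars ℤ
  have hDc : ∀ f n, coeff n (D f) = coeff (n + 1) f * (n + 1) := fun f n => coeff_derivative f n
  have hD : ∀ (f : B⟦X⟧) n, (X : B⟦X⟧) ^ (n + 1) ∣ f → (X : B⟦X⟧) ^ n ∣ D f := fun f n h =>
    X_pow_dvd_iff.2 fun m hm => by
      rw [hDc, X_pow_dvd_iff.1 h _ (Nat.succ_lt_succ hm), zero_mul]
  have hab : constantCoeff (a + b) = 0 := by simp [ha, hb]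
  set z := formalExp (a + b) - formalExp a * formalExp b with hz
  have hz0 : constantCoeff z = 0 := by
    simp [hz, constantCoeff_formalExp, ha, hb]
  have hz' : D z = z * D (a + b) := by
    rw [hz, map_sub, D.leibniz, derivation_formalExp D hD ha, derivation_formalExp D hD hb,
      derivation_formalExp D hD hab, map_add]
    simp only [smul_eq_mul]
    ring
  refine eq_of_X_pow_dvd_sub fun N => ?_
  rw [← hz]
  induction N with
  | zero => simp
  | succ N ih =>
    refine X_pow_dvd_iff.2 fun n hn => ?_
    cases n with
    | zero => simpa using hz0
    | succ n =>
      have h1 : coeff n (D z) = 0 := by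
        rw [hz']
        exact X_pow_dvd_iff.1 (ih.mul_right _) n (Nat.lt_of_succ_lt_succ hn)
      rw [hDc] at h1
      -- The recursion `(n + 1) z_{n+1} = 0` can be solved because `B` contains `ℂ`.
      have hu : IsUnit ((n : B) + 1) := by
        have : ((n : B) + 1) = algebraMap ℂ B ((n : ℂ) + 1) := by simp
        rw [this]
        exact (IsUnit.mk0 _ (Nat.cast_add_one_ne_zero n)).map _
      exact hu.mul_left_eq_zero.1 h1

/-- `a - b` divides `a ^ k - b ^ k`, so the exponential is nonexpanding in the `X`-adic metric. -/
lemma X_pow_dvd_formalExp_sub_formalExp {a b : B⟦X⟧} (ha : constantCoeff a = 0)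
    (hb : constantCoeff b = 0) {n : ℕ} (h : (X : B⟦X⟧) ^ n ∣ a - b) :
    (X : B⟦X⟧) ^ n ∣ formalExp a - formalExp b := by
  have h1 := dvd_sub (X_pow_dvd_formalExp_sub ha n) (X_pow_dvd_formalExp_sub hb n)
  have h2 : (X : B⟦X⟧) ^ n ∣ ∑ k ∈ Finset.range n, ((k.factorial : ℂ))⁻¹ • a ^ k -
      ∑ k ∈ Finset.range n, ((k.factorial : ℂ))⁻¹ • b ^ k := by
    rw [← Finset.sum_sub_distrib]
    refine Finset.dvd_sum fun k _ => ?_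
    rw [← smul_sub]
    exact dvd_smul_of_dvd _ (h.trans (sub_dvd_pow_sub_pow a b k))
  have := dvd_add h1 h2
  rwa [show ∀ x y z w : B⟦X⟧, x - y - (z - w) + (y - w) = x - z by intros; ring] at this

end FormalExp

/-! ### Coordinates of vectors with formal coefficients -/

section Pairing

variable {V : Type*} [NormedAddCommGroup V] [InnerProductSpace ℝ V] [FiniteDimensional ℝ V]
variable {B : Type*} [CommRing B] [Algebra ℝ B]

lemma pairing_tmul (x : V) (b : B) (y : V) : pairing B x (b ⊗ₜ y) = ⟪x, y⟫_ℝ • b := by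
  simp [pairing, Algebra.smul_def, mul_comm]

lemma pairing_add_left (x y : V) (w : B ⊗[ℝ] V) :
    pairing B (x + y) w = pairing B x w + pairing B y w := by
  induction w with
  | zero => simp
  | tmul b z => simp [pairing_tmul, inner_add_left, add_smul]
  | add u v hu hv => rw [map_add, hu, hv, map_add, map_add]; ring

lemma pairing_zero_left (w : B ⊗[ℝ] V) : pairing B (0 : V) w = 0 := by
  simpa using pairing_add_left (0 : V) 0 w

lemma pairing_eq_sum (x : V) (w : B ⊗[ℝ] V) :
    pairing B x w = ∑ j, ⟪x, stdOrthonormalBasis ℝ V j⟫_ℝ •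
      pairing B (stdOrthonormalBasis ℝ V j) w := by
  induction w with
  | zero => simp
  | tmul b z =>
    simp only [pairing_tmul, smul_smul, ← Finset.sum_smul]
    rw [OrthonormalBasis.sum_inner_mul_inner]
  | add u v hu hv => simp only [map_add, hu, hv, smul_add, Finset.sum_add_distrib]

lemma sum_pairing_tmul (w : B ⊗[ℝ] V) :
    ∑ j, pairing B (stdOrthonormalBasis ℝ V j) w ⊗ₜ[ℝ] stdOrthonormalBasis ℝ V j = w := by
  induction w with
  | zero => simp
  | tmul b z =>
    simp only [pairing_tmul, TensorProduct.smul_tmul, ← TensorProduct.tmul_sum]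
    rw [OrthonormalBasis.sum_repr']
  | add u v hu hv =>
    simp only [map_add, TensorProduct.add_tmul, Finset.sum_add_distrib, hu, hv]

lemma pairing_ext {w w' : B ⊗[ℝ] V} (h : ∀ j, pairing B (stdOrthonormalBasis ℝ V j) w =
    pairing B (stdOrthonormalBasis ℝ V j) w') : w = w' := by
  rw [← sum_pairing_tmul w, ← sum_pairing_tmul w']
  simp only [h]

lemma pairing_sum_tmul (x : Fin (Module.finrank ℝ V) → B) (k : Fin (Module.finrank ℝ V)) :
    pairing B (stdOrthonormalBasis ℝ V k) (∑ j, x j ⊗ₜ[ℝ] stdOrthonormalBasis ℝ V j) = x k := by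
  simp [pairing_tmul, OrthonormalBasis.inner_eq_ite]

lemma pairing_rTensor {B' : Type*} [CommRing B'] [Algebra ℝ B'] (φ : B →ₗ[ℝ] B') (x : V)
    (w : B ⊗[ℝ] V) : pairing B' x (LinearMap.rTensor V φ w) = φ (pairing B x w) := by
  induction w with
  | zero => simp
  | tmul b z => simp [pairing_tmul]
  | add u v hu hv => simp only [map_add, hu, hv]

end Pairing

/-! ### Characters as multiplicative functions of the weight -/

section Character

variable {V : Type*} [NormedAddCommGroup V] [InnerProductSpace ℝ V] [FiniteDimensional ℝ V]
variable {P : Submodule ℤ V}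

lemma character_zero (u : Torus P) : character P 0 u = 1 := by
  simp [character]

lemma character_add (lam mu : weightLattice P) (u : Torus P) :
    character P (lam + mu) u = character P lam u * character P mu u := by
  simp only [character, ← Complex.exp_add, Submodule.coe_add, inner_add_left, Complex.ofReal_add,
    mul_add]

lemma norm_character (lam : weightLattice P) (u : Torus P) : ‖character P lam u‖ = 1 := by
  rw [character, show ∀ r : ℝ, (2 * Real.pi * Complex.I * (r : ℂ)) =
    ((2 * Real.pi * r : ℝ) : ℂ) * Complex.I by intro r; push_cast; ring,
    Complex.norm_exp_ofReal_mul_I]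

lemma linExt_single {M : Type*} [AddCommGroup M] [Module ℂ M] (h : weightLattice P → M)
    (lam : weightLattice P) (c : ℂ) : linExt P h (AddMonoidAlgebra.single lam c) = c • h lam := by
  simp [linExt]

lemma linExt_mul {B : Type*} [CommRing B] [Algebra ℂ B] (h : weightLattice P → B)
    (hadd : ∀ lam mu, h (lam + mu) = h lam * h mu) (p q : RepRing P) :
    linExt P h (p * q) = linExt P h p * linExt P h q := by
  induction p using AddMonoidAlgebra.induction_linear with
  | zero => simp
  | add p p' hp hp' => rw [add_mul, map_add, hp, hp', map_add, add_mul]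
  | single lam c =>
    induction q using AddMonoidAlgebra.induction_linear with
    | zero => simp
    | add q q' hq hq' => rw [mul_add, map_add, hq, hq', map_add, mul_add]
    | single mu d =>
      simp only [AddMonoidAlgebra.single_mul_single, linExt_single, hadd, smul_mul_smul_comm]

end Character

/-! ### Evaluation at a jet is an algebra homomorphism -/

section JetEval

open PowerSeries

variable {V : Type*} [NormedAddCommGroup V] [InnerProductSpace ℝ V] [FiniteDimensional ℝ V]
variable {P : Submodule ℤ V}

lemma Jet.constantCoeff_pairing_log (γ : Jet P) (x : V) :
    constantCoeff (pairing ℂ⟦X⟧ x γ.log) = 0 := by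
  obtain ⟨w, hw⟩ := γ.log_mem
  simp [hw]

lemma Jet.constantCoeff_smul_pairing_log (γ : Jet P) (c : ℂ) (x : V) :
    constantCoeff (c • pairing ℂ⟦X⟧ x γ.log) = 0 := by
  rw [← coeff_zero_eq_constantCoeff_apply, PowerSeries.coeff_smul,
    coeff_zero_eq_constantCoeff_apply, γ.constantCoeff_pairing_log, smul_zero]

lemma Jet.character_add (γ : Jet P) (lam mu : weightLattice P) :
    γ.character (lam + mu) = γ.character lam * γ.character mu := by
  rw [Jet.character, Submodule.coe_add, pairing_add_left, smul_add,
    formalExp_add (γ.constantCoeff_smul_pairing_log _ _) (γ.constantCoeff_smul_pairing_log _ _),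
    FormalTorus.character_add, Jet.character, Jet.character, smul_mul_smul_comm]

lemma Jet.character_zero (γ : Jet P) : γ.character 0 = 1 := by
  rw [Jet.character, Submodule.coe_zero, pairing_zero_left, smul_zero, formalExp_zero,
    FormalTorus.character_zero, one_smul]

lemma Jet.coeff_eval (γ : Jet P) (f : (RepRing P)⟦X⟧) (n : ℕ) :
    coeff n (γ.eval f) = ∑ p ∈ Finset.HasAntidiagonal.antidiagonal n,
      coeff p.2 (linExt P γ.character (coeff p.1 f)) := by
  simp [Jet.eval]

lemma Jet.eval_C (γ : Jet P) (p : RepRing P) : γ.eval (C p) = linExt P γ.character p := by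
  ext n
  rw [γ.coeff_eval, Finset.sum_eq_single (0, n)]
  · simp
  · rintro ⟨i, j⟩ hij hne
    have : i ≠ 0 := by
      rintro rfl
      exact hne (by simpa using hij)
    simp [coeff_C, this]
  · simp

lemma Jet.eval_X_mul (γ : Jet P) (f : (RepRing P)⟦X⟧) : γ.eval (X * f) = X * γ.eval f := by
  ext n
  cases n with
  | zero => simp [γ.coeff_eval]
  | succ n => simp [γ.coeff_eval, Finset.Nat.sum_antidiagonal_succ, coeff_succ_X_mul]

lemma Jet.eval_X_pow_mul (γ : Jet P) (n : ℕ) (f : (RepRing P)⟦X⟧) :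
    γ.eval (X ^ n * f) = X ^ n * γ.eval f := by
  induction n with
  | zero => simp
  | succ n ih => rw [pow_succ', mul_assoc, γ.eval_X_mul, ih, pow_succ', mul_assoc]

lemma Jet.X_pow_dvd_eval (γ : Jet P) {n : ℕ} {f : (RepRing P)⟦X⟧} (h : X ^ n ∣ f) :
    X ^ n ∣ γ.eval f := by
  obtain ⟨g, rfl⟩ := h
  rw [γ.eval_X_pow_mul]
  exact dvd_mul_right _ _

lemma X_pow_dvd_sub_sum {B : Type*} [CommRing B] (f : B⟦X⟧) (N : ℕ) :
    (X : B⟦X⟧) ^ N ∣ f - ∑ a ∈ Finset.range N, X ^ a * C (coeff a f) := by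
  refine X_pow_dvd_iff.2 fun n hn => ?_
  simp only [map_sub, map_sum, coeff_X_pow_mul', coeff_C]
  rw [Finset.sum_eq_single n]
  · simp
  · intro b _ hb
    split_ifs <;> first | rfl | omega
  · simp [hn]

/-- Modulo `X ^ N` both factors are polynomials in `t` over `ℂ R(T)`. There multiplicativity reduces
to `γ ^ (lam + mu) = γ ^ lam γ ^ mu`. -/
lemma Jet.eval_mul (γ : Jet P) (f g : (RepRing P)⟦X⟧) : γ.eval (f * g) = γ.eval f * γ.eval g := by
  refine eq_of_X_pow_dvd_sub fun N => ?_
  set F := ∑ a ∈ Finset.range N, X ^ a * C (coeff a f) with hF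
  set G := ∑ a ∈ Finset.range N, X ^ a * C (coeff a g) with hG
  have hf := X_pow_dvd_sub_sum f N
  have hg := X_pow_dvd_sub_sum g N
  rw [← hF] at hf
  rw [← hG] at hg
  have h1 : γ.eval (F * G) = γ.eval F * γ.eval G := by
    rw [hF, hG, Finset.sum_mul_sum]
    simp only [map_sum, Finset.sum_mul_sum]
    refine Finset.sum_congr rfl fun a _ => Finset.sum_congr rfl fun b _ => ?_
    rw [show (X ^ a * C (coeff a f) * (X ^ b * C (coeff b g)) : (RepRing P)⟦X⟧) =
      X ^ (a + b) * C (coeff a f * coeff b g) by rw [map_mul]; ring]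
    rw [γ.eval_X_pow_mul, γ.eval_X_pow_mul, γ.eval_X_pow_mul, γ.eval_C, γ.eval_C, γ.eval_C,
      linExt_mul _ γ.character_add]
    ring
  have h2 : X ^ N ∣ f * g - F * G := by
    rw [show f * g - F * G = (f - F) * g + F * (g - G) by ring]
    exact dvd_add (hf.mul_right _) (hg.mul_left _)
  have h3 := γ.X_pow_dvd_eval h2
  have h4 := γ.X_pow_dvd_eval hf
  have h5 := γ.X_pow_dvd_eval hg
  rw [map_sub] at h3 h4 h5
  rw [h1] at h3
  rw [show γ.eval (f * g) - γ.eval f * γ.eval g = (γ.eval (f * g) - γ.eval F * γ.eval G) -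
    ((γ.eval f - γ.eval F) * γ.eval g + γ.eval F * (γ.eval g - γ.eval G)) by ring]
  exact dvd_sub h3 (dvd_add (h4.mul_right _) (h5.mul_left _))

lemma Jet.eval_one (γ : Jet P) : γ.eval 1 = 1 := by
  have := γ.eval_C 1
  rwa [map_one, AddMonoidAlgebra.one_def, linExt_single, γ.character_zero, one_smul] at this

/-- Evaluation at a jet as a homomorphism of algebras. -/
def Jet.evalHom (γ : Jet P) : (RepRing P)⟦X⟧ →ₐ[ℂ] ℂ⟦X⟧ :=
  AlgHom.ofLinearMap γ.eval γ.eval_one γ.eval_mul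

lemma Jet.evalHom_apply (γ : Jet P) (f : (RepRing P)⟦X⟧) : γ.evalHom f = γ.eval f := rfl

lemma Jet.evalHom_X (γ : Jet P) : γ.evalHom X = X := by
  have := γ.eval_X_mul 1
  rwa [mul_one, γ.eval_one, mul_one] at this

lemma Jet.constantCoeff_eval (γ : Jet P) (f : (RepRing P)⟦X⟧) :
    constantCoeff (γ.eval f) = repEval P (constantCoeff f) γ.base := by
  rw [← coeff_zero_eq_constantCoeff_apply, γ.coeff_eval]
  simp only [Finset.Nat.antidiagonal_zero, Finset.sum_singleton, coeff_zero_eq_constantCoeff]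
  generalize constantCoeff f = p
  induction p using AddMonoidAlgebra.induction_linear with
  | zero => simp [repEval]
  | add p q hp hq => rw [repEval, map_add, map_add, map_add, hp, hq]; rfl
  | single lam c =>
    rw [repEval, linExt_single, linExt_single, Jet.character, ← coeff_zero_eq_constantCoeff_apply,
      PowerSeries.coeff_smul, PowerSeries.coeff_smul, coeff_zero_eq_constantCoeff_apply,
      constantCoeff_formalExp (γ.constantCoeff_smul_pairing_log _ _)]
    simp

lemma pairing_eval (v : VectorField P) (γ : Jet P) (x : V) :
    pairing ℂ⟦X⟧ x (v.eval γ) = γ.eval (pairing _ x v) :=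
  pairing_rTensor _ _ _

lemma constantCoeff_smul_X_mul {B : Type*} [CommRing B] [Algebra ℂ B] (c : ℂ) (f : B⟦X⟧) :
    constantCoeff (c • (X * f)) = 0 := by
  rw [← mul_smul_comm]
  simp

/-- Evaluation is an algebra homomorphism fixing `X`, so it passes through the exponential. This is
the consistency between the two descriptions of `Φ_t`, on characters and on jets. -/
lemma eval_phiCharacter {m : ℕ} (S : Fin m → Submodule ℝ V) (l : Fin m → ℕ) (v : VectorField P)
    (γ : Jet P) (lam : weightLattice P) :
    γ.eval (phiCharacter S l v lam) = (phiJet S l v γ).character lam := by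
  rw [phiCharacter, γ.eval_mul, γ.eval_C, linExt_single, one_smul, ← γ.evalHom_apply,
    map_formalExp _ γ.evalHom_X (constantCoeff_smul_X_mul _ _), Jet.character, Jet.character]
  simp only [phiJet, map_add, map_smul, map_mul, γ.evalHom_X, smul_add]
  rw [formalExp_add (γ.constantCoeff_smul_pairing_log _ _), smul_mul_assoc, pairing_eval,
    smul_eq_mul, γ.evalHom_apply]
  exact constantCoeff_smul_X_mul _ _

/-- Jets with the same base point that agree modulo `t ^ n` give values that agree modulo `t ^ n`;
this supplies the contraction estimate for solving `Φ_t(g_t) = g`. -/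
lemma Jet.X_pow_dvd_eval_sub_eval {γ γ' : Jet P} (hb : γ.base = γ'.base) {n : ℕ}
    (h : ∀ x, X ^ n ∣ pairing ℂ⟦X⟧ x γ.log - pairing ℂ⟦X⟧ x γ'.log) (f : (RepRing P)⟦X⟧) :
    X ^ n ∣ γ.eval f - γ'.eval f := by
  have key : ∀ p : RepRing P, X ^ n ∣ linExt P γ.character p - linExt P γ'.character p := by
    intro p
    induction p using AddMonoidAlgebra.induction_linear with
    | zero => simp
    | add p q hp hq => rw [map_add, map_add, add_sub_add_comm]; exact dvd_add hp hq
    | single lam c =>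
      rw [linExt_single, linExt_single, ← smul_sub, Jet.character, Jet.character, ← hb, ← smul_sub]
      refine dvd_smul_of_dvd _ (dvd_smul_of_dvd _ (X_pow_dvd_formalExp_sub_formalExp
        (γ.constantCoeff_smul_pairing_log _ _) (γ'.constantCoeff_smul_pairing_log _ _) ?_))
      rw [← smul_sub]
      exact dvd_smul_of_dvd _ (h _)
  refine X_pow_dvd_iff.2 fun k hk => ?_
  rw [map_sub, γ.coeff_eval, γ'.coeff_eval, ← Finset.sum_sub_distrib]
  refine Finset.sum_eq_zero fun p hp => ?_
  rw [← map_sub]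
  exact X_pow_dvd_iff.1 (key _) _ (by have := Finset.HasAntidiagonal.mem_antidiagonal.1 hp; omega)

end JetEval

/-! ### Contraction principle for formal series -/

section FixedPoint

open PowerSeries

/-- The Banach fixed point theorem for the `X`-adic metric: `H` gains one power of `X`, so the
iterates of `0` stabilize in each degree. -/
lemma existsUnique_fixedPoint_of_X_pow_dvd {B : Type*} [CommRing B] {ι : Type*}
    (H : (ι → B⟦X⟧) → ι → B⟦X⟧)
    (hH : ∀ (n : ℕ) x y, (∀ i, X ^ n ∣ x i - y i) → ∀ i, X ^ (n + 1) ∣ H x i - H y i) :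
    ∃! x, H x = x := by
  let x : ℕ → ι → B⟦X⟧ := fun k => H^[k] 0
  have hx : ∀ k, x (k + 1) = H (x k) := fun k => Function.iterate_succ_apply' _ _ _
  have h1 : ∀ k i, X ^ k ∣ x (k + 1) i - x k i := by
    intro k
    induction k with
    | zero => simp
    | succ k ih =>
      rw [hx (k + 1), hx k]
      rw [hx k] at ih
      exact hH _ _ _ ih
  have h2 : ∀ n k i, n < k → coeff n (x k i) = coeff n (x (n + 1) i) := by
    intro n k i hk
    induction k, hk using Nat.le_induction with
    | base => rfl
    | succ k hk ih =>
      rw [← ih, ← sub_eq_zero, ← map_sub]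
      exact X_pow_dvd_iff.1 (h1 k i) n hk
  -- The coefficient of degree `n` no longer changes from iterate `n + 1` on.
  let y : ι → B⟦X⟧ := fun i => PowerSeries.mk fun n => coeff n (x (n + 1) i)
  have hy : ∀ k i, X ^ k ∣ y i - x k i := fun k i => X_pow_dvd_iff.2 fun n hn => by
    simp [y, h2 n k i hn]
  refine ⟨y, funext fun i => eq_of_X_pow_dvd_sub fun N => ?_, fun z hz => ?_⟩
  · have h3 := hH N _ _ (hy N) i
    rw [← hx] at h3
    have h4 := dvd_sub h3 (hy (N + 1) i)
    rw [sub_sub_sub_cancel_right] at h4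
    exact (pow_dvd_pow _ N.le_succ).trans h4
  · have h5 : ∀ N i, X ^ N ∣ z i - x N i := by
      intro N
      induction N with
      | zero => simp
      | succ N ih =>
        have := hH N _ _ ih
        rwa [hz, ← hx] at this
    refine funext fun i => eq_of_X_pow_dvd_sub fun N => ?_
    simpa using dvd_sub (h5 N i) (hy N i)

end FixedPoint

/-! ### Solving `Φ_t(g_t) = g` -/

section JetSolution

open PowerSeries

variable {V : Type*} [NormedAddCommGroup V] [InnerProductSpace ℝ V] [FiniteDimensional ℝ V]
variable {P : Submodule ℤ V}

/-- Writing `g_t⁺ = t x` and cancelling one `t`, the equation becomes `x = -ℓ⁻¹ v_t(g exp(t x))`.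
The remaining `t` in front of `x` makes the right side a contraction. -/
lemma existsUnique_phiJet_eq_const {m : ℕ} (S : Fin m → Submodule ℝ V) (l : Fin m → ℕ)
    (v : VectorField P) (g : Torus P) : ∃! γ : Jet P, phiJet S l v γ = Jet.const g := by
  let e := stdOrthonormalBasis ℝ V
  let T : (Fin (Module.finrank ℝ V) → ℂ⟦X⟧) → ℂ⟦X⟧ ⊗[ℝ] V := fun x => ∑ j, x j ⊗ₜ[ℝ] e j
  let J : (Fin (Module.finrank ℝ V) → ℂ⟦X⟧) → Jet P := fun x =>
    ⟨g, (X : ℂ⟦X⟧) • T x, ⟨_, rfl⟩⟩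
  let H : (Fin (Module.finrank ℝ V) → ℂ⟦X⟧) → Fin (Module.finrank ℝ V) → ℂ⟦X⟧ := fun x i =>
    -(J x).eval (pairing _ (e i) (rescaled S l v))
  have hT : ∀ x k, pairing ℂ⟦X⟧ (e k) (T x) = x k := pairing_sum_tmul
  have hH : ∀ (n : ℕ) x y, (∀ i, X ^ n ∣ x i - y i) → ∀ i, X ^ (n + 1) ∣ H x i - H y i := by
    intro n x y hxy i
    have hxy' : ∀ z, X ^ (n + 1) ∣ pairing ℂ⟦X⟧ z (J x).log - pairing ℂ⟦X⟧ z (J y).log := ?_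
    · have h1 := Jet.X_pow_dvd_eval_sub_eval (γ := J x) (γ' := J y) rfl hxy'
        (pairing _ (e i) (rescaled S l v))
      have h2 : H x i - H y i = -((J x).eval (pairing _ (e i) (rescaled S l v)) -
        (J y).eval (pairing _ (e i) (rescaled S l v))) := by
        simp only [H]
        ring
      rw [h2]
      exact (dvd_neg (α := ℂ⟦X⟧)).2 h1
    intro z
    rw [pairing_eq_sum z (J x).log, pairing_eq_sum z (J y).log, ← Finset.sum_sub_distrib]
    refine Finset.dvd_sum fun j _ => ?_
    rw [← smul_sub]
    refine dvd_smul_of_dvd _ ?_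
    change X ^ (n + 1) ∣ pairing ℂ⟦X⟧ (e j) ((X : ℂ⟦X⟧) • T x) -
      pairing ℂ⟦X⟧ (e j) ((X : ℂ⟦X⟧) • T y)
    rw [map_smul, map_smul, hT, hT, smul_eq_mul, smul_eq_mul, ← mul_sub, pow_succ']
    exact mul_dvd_mul_left _ (hxy j)
  have key : ∀ x, phiJet S l v (J x) = Jet.const g ↔ H x = x := by
    intro x
    have : phiJet S l v (J x) = Jet.const g ↔
        (X : ℂ⟦X⟧) • T x + (X : ℂ⟦X⟧) • (rescaled S l v).eval (J x) = 0 := by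
      exact ⟨fun h => congrArg Jet.log h, fun h => Jet.ext rfl h⟩
    rw [this]
    constructor
    · intro h
      funext k
      have h1 := congrArg (pairing ℂ⟦X⟧ (e k)) h
      rw [← smul_add, map_smul, map_add, hT, pairing_eval, map_zero, smul_eq_mul] at h1
      have h2 := (mul_eq_zero.1 h1).resolve_left X_ne_zero
      exact (eq_neg_of_add_eq_zero_left h2).symm
    · intro h
      refine pairing_ext fun k => ?_
      rw [← smul_add, map_smul, map_add, hT, pairing_eval, map_zero]
      nth_rw 1 [← h]
      simp [H, e]
  obtain ⟨x, hx, hu⟩ := existsUnique_fixedPoint_of_X_pow_dvd H hH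
  refine ⟨J x, (key x).2 hx, fun γ hγ => ?_⟩
  obtain ⟨b, lg, w, rfl⟩ := γ
  obtain rfl : b = g := congrArg Jet.base hγ
  have hw : T (fun j => pairing ℂ⟦X⟧ (e j) w) = w := sum_pairing_tmul w
  have hJ : J (fun j => pairing ℂ⟦X⟧ (e j) w) = ⟨b, (X : ℂ⟦X⟧) • w, ⟨w, rfl⟩⟩ := by
    simp only [J, hw]
  rw [← hJ] at hγ ⊢
  rw [hu _ ((key _).1 hγ)]

lemma eval_phiCharacter_of_phiJet_eq_const {m : ℕ} {S : Fin m → Submodule ℝ V} {l : Fin m → ℕ}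
    {v : VectorField P} {γ : Jet P} {g : Torus P} (h : phiJet S l v γ = Jet.const g)
    (lam : weightLattice P) : γ.eval (phiCharacter S l v lam) = C (character P lam g) := by
  rw [eval_phiCharacter, h, Jet.character]
  simp only [Jet.const, map_zero, smul_zero, formalExp_zero]
  rw [Algebra.smul_def, mul_one]
  rfl

end JetSolution

/-! ### The Piola identity and algebraic change of variables -/

section Piola

variable {R : Type*} [CommRing R] [Algebra ℂ R] {ι : Type*} [Fintype ι] [DecidableEq ι]

lemma derivation_prod {κ : Type*} [DecidableEq κ] (D : Derivation ℂ R R) (s : Finset κ)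
    (f : κ → R) :
    D (∏ i ∈ s, f i) = ∑ i ∈ s, D (f i) * ∏ j ∈ s.erase i, f j := by
  induction s using Finset.induction_on with
  | empty => simp
  | insert a s ha ih =>
    rw [Finset.prod_insert ha, D.leibniz, ih, Finset.sum_insert ha, Finset.erase_insert ha,
      smul_eq_mul, smul_eq_mul, Finset.mul_sum, add_comm, mul_comm]
    congr 1
    refine Finset.sum_congr rfl fun i hi => ?_
    have hia : a ≠ i := fun h => ha (h ▸ hi)
    rw [Finset.erase_insert_of_ne hia, Finset.prod_insert (fun h => ha (Finset.mem_of_mem_erase h))]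
    ring

lemma det_updateRow_eq_sum (A : Matrix ι ι R) (i : ι) (r : ι → R) :
    (A.updateRow i r).det = ∑ c, r c * (A.updateRow i (Pi.single c 1)).det := by
  rw [Matrix.det_eq_sum_mul_adjugate_row _ i]
  simp [Matrix.adjugate_apply, Matrix.updateRow_idem]

lemma det_eq_sum_sign_smul_prod (A : Matrix ι ι R) :
    A.det = ∑ σ : Equiv.Perm ι, Equiv.Perm.sign σ • ∏ i, A i (σ i) := by
  rw [← Matrix.det_transpose, Matrix.det_apply]
  rfl

lemma derivation_det (D : Derivation ℂ R R) (A : Matrix ι ι R) :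
    D A.det = ∑ i, (A.updateRow i fun c => D (A i c)).det := by
  rw [det_eq_sum_sign_smul_prod A, map_sum]
  have h1 : ∀ i, (A.updateRow i fun c => D (A i c)).det = ∑ σ : Equiv.Perm ι,
      Equiv.Perm.sign σ • (D (A i (σ i)) * ∏ j ∈ Finset.univ.erase i, A j (σ j)) := by
    intro i
    rw [det_eq_sum_sign_smul_prod]
    refine Finset.sum_congr rfl fun σ _ => ?_
    rw [← Finset.mul_prod_erase _ _ (Finset.mem_univ i)]
    congr 2
    · simp
    · refine Finset.prod_congr rfl fun j hj => ?_
      simp [Finset.ne_of_mem_erase hj]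
  simp only [h1]
  rw [Finset.sum_comm]
  refine Finset.sum_congr rfl fun σ _ => ?_
  rw [← Finset.smul_sum, Units.smul_def, Units.smul_def, map_zsmul, derivation_prod]

/-- The Piola identity: the columns of the cofactor matrix of a Jacobian are divergence-free. -/
lemma sum_derivation_adjugate (D : ι → Derivation ℂ R R) (A : Matrix ι ι R)
    (hA : ∀ i j k, D k (A i j) = D j (A i k)) (k : ι) : ∑ j, D j (A.adjugate j k) = 0 := by
  -- The entry `(j, k)` of the adjugate is the determinant of `A` with row `k` replaced by `e_j`.
  -- That row is constant, so only the other rows `i` contribute, each expanded in unit vectors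
  -- `e_c`.
  have h1 : ∀ j, D j (A.adjugate j k) = ∑ i ∈ Finset.univ.erase k, ∑ c, D j (A i c) *
      ((A.updateRow k (Pi.single j 1)).updateRow i (Pi.single c 1)).det := by
    intro j
    rw [Matrix.adjugate_apply, derivation_det, ← Finset.add_sum_erase _ _ (Finset.mem_univ k)]
    have hk : ((A.updateRow k (Pi.single j 1)).updateRow k fun c =>
        D j ((A.updateRow k (Pi.single j 1)) k c)).det = 0 := by
      refine Matrix.det_eq_zero_of_row_eq_zero k fun c => ?_
      rw [Matrix.updateRow_self, Matrix.updateRow_self, Pi.single_apply]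
      split_ifs <;> simp
    rw [hk, zero_add]
    refine Finset.sum_congr rfl fun i hi => ?_
    have hik := Finset.ne_of_mem_erase hi
    rw [det_updateRow_eq_sum]
    simp only [Matrix.updateRow_ne hik]
  simp only [h1]
  rw [Finset.sum_comm]
  refine Finset.sum_eq_zero fun i hi => ?_
  have hik := Finset.ne_of_mem_erase hi
  set S := ∑ j, ∑ c, D j (A i c) *
    ((A.updateRow k (Pi.single j 1)).updateRow i (Pi.single c 1)).det with hS
  -- Exchanging `j` and `c` preserves `D j (A i c)` by the symmetry of second derivatives, but swaps
  -- two rows of the determinant.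
  have h3 : S = -S := by
    conv_lhs => rw [hS, Finset.sum_comm]
    rw [hS, ← Finset.sum_neg_distrib]
    refine Finset.sum_congr rfl fun c _ => ?_
    rw [← Finset.sum_neg_distrib]
    refine Finset.sum_congr rfl fun j _ => ?_
    rw [hA i c j, ← mul_neg]
    congr 1
    have h4 := Matrix.det_permute (Equiv.swap i k)
      ((A.updateRow k (Pi.single c 1)).updateRow i (Pi.single j 1))
    rw [Equiv.Perm.sign_swap hik] at h4
    simp only [Units.val_neg, Units.val_one, Int.cast_neg, Int.cast_one, neg_mul, one_mul] at h4
    rw [← h4]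
    congr 1
    ext a b
    simp only [Matrix.submatrix_apply, id]
    rcases eq_or_ne a i with rfl | hai
    · simp [hik.symm]
    rcases eq_or_ne a k with rfl | hak
    · simp [hik.symm]
    · simp [Equiv.swap_apply_of_ne_of_ne hai hak, hai, hak]
  have h5 : (2 : ℂ) • S = 0 := by
    rw [two_smul]
    nth_rw 1 [h3]
    exact neg_add_cancel S
  exact (smul_eq_zero.1 h5).resolve_left two_ne_zero

/-- The formal change of variables formula for a character: `E = u^c ∘ Φ` has the logarithmic
derivative `c dΦ`, so `c E det(dΦ)` is a divergence. -/
lemma linearMap_mul_det_eq_zero {M : Type*} [AddCommGroup M] [Module ℂ M] (ε : R →ₗ[ℂ] M)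
    (D : ι → Derivation ℂ R R) (hε : ∀ j f, ε (D j f) = 0) (A : Matrix ι ι R)
    (hA : ∀ i j k, D k (A i j) = D j (A i k)) (E : R) (c : ι → ℂ)
    (hE : ∀ j, D j E = E * ∑ i, c i • A i j) (hc : c ≠ 0) : ε (E * A.det) = 0 := by
  obtain ⟨k, hk⟩ := Function.ne_iff.1 hc
  -- Divergence of `E` times column `k` of the adjugate: the derivatives of the adjugate cancel by
  -- Piola, and `A * adj A = det A` keeps only the term `c k` of the logarithmic derivative of `E`.
  have h1 : ∑ j, D j (E * A.adjugate j k) = c k • (E * A.det) := by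
    simp only [Derivation.leibniz, smul_eq_mul, Finset.sum_add_distrib, ← Finset.mul_sum]
    rw [sum_derivation_adjugate D A hA, mul_zero, zero_add]
    have h2 : ∀ i, ∑ j, A i j * A.adjugate j k = if i = k then A.det else 0 := by
      intro i
      rw [← Matrix.mul_apply, Matrix.mul_adjugate, Matrix.smul_apply, Matrix.one_apply]
      simp
    have h3 : ∀ j, A.adjugate j k * D j E = E * ∑ i, c i • (A i j * A.adjugate j k) := by
      intro j
      rw [hE, mul_left_comm, Finset.mul_sum]
      congr 1
      refine Finset.sum_congr rfl fun i _ => ?_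
      rw [mul_smul_comm, mul_comm]
    simp only [h3, ← Finset.mul_sum]
    rw [Finset.sum_comm]
    simp [← Finset.smul_sum, h2]
  have h2 := congrArg ε h1
  rw [map_sum, Finset.sum_eq_zero fun j _ => hε j _, map_smul] at h2
  exact (smul_eq_zero.1 h2.symm).resolve_left hk

/-- The rows of `Dy` are switched on one at a time. Each step adds `∑ j, D j (y k) adj j k`, a
divergence by Piola. This is the case of the constant function, where no nonzero `c k` is available.
-/
lemma linearMap_det_eq {M : Type*} [AddCommGroup M] [Module ℂ M] (ε : R →ₗ[ℂ] M)
    (D : ι → Derivation ℂ R R) (hε : ∀ j f, ε (D j f) = 0)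
    (hD : ∀ j k f, D j (D k f) = D k (D j f)) (y : ι → R) :
    ε (1 + Matrix.of fun i j => D j (y i)).det = ε 1 := by
  -- Jacobian of the map that displaces only the coordinates in `s`, hence again subject to the
  -- symmetry `hB`.
  let B : Finset ι → Matrix ι ι R := fun s => Matrix.of fun i j =>
    (1 : Matrix ι ι R) i j + if i ∈ s then D j (y i) else 0
  have hB : ∀ s i j k, D k (B s i j) = D j (B s i k) := by
    intro s i j k
    have h1 : ∀ a b c, D a ((1 : Matrix ι ι R) b c) = 0 := by
      intro a b c
      rw [Matrix.one_apply]
      split_ifs <;> simp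
    simp only [B, Matrix.of_apply, map_add, h1, zero_add]
    split_ifs
    · exact hD _ _ _
    · simp
  have key : ∀ s, ε (B s).det = ε 1 := by
    intro s
    induction s using Finset.induction_on with
    | empty =>
      congr 1
      rw [← Matrix.det_one (n := ι)]
      congr 1
      ext i j
      simp [B]
    | insert k s hk ih =>
      have h1 : B (insert k s) = (B s).updateRow k (B s k + fun j => D j (y k)) := by
        ext i j
        rcases eq_or_ne i k with rfl | hik
        · simp [B, hk]
        · simp [B, hik]
      have h2 : ((B s).updateRow k fun j => D j (y k)).det =
          ∑ j, D j (y k * (B s).adjugate j k) := by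
        simp only [Derivation.leibniz, smul_eq_mul, Finset.sum_add_distrib, ← Finset.mul_sum]
        rw [sum_derivation_adjugate D _ (hB s), mul_zero, zero_add,
          det_updateRow_eq_sum]
        refine Finset.sum_congr rfl fun j _ => ?_
        rw [Matrix.adjugate_apply, mul_comm]
      rw [h1, Matrix.det_updateRow_add, Matrix.updateRow_eq_self, map_add, ih, h2, map_sum,
        Finset.sum_eq_zero fun j _ => hε j _, add_zero]
  rw [← key Finset.univ]
  congr 2
  ext i j
  simp [B]

end Piola

/-! ### Derivations of the series ring and integration over the torus -/

section Derivation

open PowerSeries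

variable {V : Type*} [NormedAddCommGroup V] [InnerProductSpace ℝ V] [FiniteDimensional ℝ V]
variable {P : Submodule ℤ V}

lemma repDeriv_single (ξ : V) (lam : weightLattice P) (c : ℂ) :
    repDeriv ξ (AddMonoidAlgebra.single lam c : RepRing P) = AddMonoidAlgebra.single lam
      (c * (2 * Real.pi * Complex.I * ((⟪(lam : V), ξ⟫_ℝ : ℝ) : ℂ))) := by
  rw [repDeriv, linExt_single, AddMonoidAlgebra.smul_single, smul_eq_mul]

lemma repDeriv_mul (ξ : V) (p q : RepRing P) :
    repDeriv ξ (p * q) = p * repDeriv ξ q + q * repDeriv ξ p := by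
  induction p using AddMonoidAlgebra.induction_linear with
  | zero => simp
  | add p p' hp hp' => rw [add_mul, map_add, hp, hp', map_add]; ring
  | single lam c =>
    induction q using AddMonoidAlgebra.induction_linear with
    | zero => simp
    | add q q' hq hq' => rw [mul_add, map_add, hq, hq', map_add]; ring
    | single mu d =>
      simp only [AddMonoidAlgebra.single_mul_single, repDeriv_single]
      rw [add_comm mu lam, ← AddMonoidAlgebra.single_add]
      congr 1
      rw [Submodule.coe_add, inner_add_left]
      push_cast
      ring

lemma repDeriv_comm (ξ ζ : V) (p : RepRing P) :
    repDeriv ξ (repDeriv ζ p) = repDeriv ζ (repDeriv ξ p) := by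
  induction p using AddMonoidAlgebra.induction_linear with
  | zero => simp
  | add p q hp hq => simp only [map_add, hp, hq]
  | single lam c =>
    simp only [repDeriv_single]
    congr 1
    ring

/-- Stokes' theorem on the torus in algebraic form: `u ^ lam` is multiplied by a multiple of `lam ·
ξ`, which is zero for `lam = 0`. -/
lemma coeff_zero_repDeriv (ξ : V) (p : RepRing P) : (repDeriv ξ p).coeff 0 = 0 := by
  induction p using AddMonoidAlgebra.induction_linear with
  | zero => simp
  | add p q hp hq => simp [map_add, hp, hq]
  | single lam c =>
    rw [repDeriv_single, AddMonoidAlgebra.coeff_single]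
    rcases eq_or_ne lam 0 with rfl | h
    · simp
    · simp [h]

/-- The derivative in the direction `ξ` as a derivation of `ℂ R(T)[[t]]`. -/
def seriesDerivation (P : Submodule ℤ V) (ξ : V) :
    Derivation ℂ (RepRing P)⟦X⟧ (RepRing P)⟦X⟧ :=
  Derivation.mk'
    { toFun := seriesDeriv P ξ
      map_add' := map_add _
      map_smul' := fun c f => by
        ext1 n
        simp [seriesDeriv] }
    (fun f g => by
      ext1 n
      simp only [seriesDeriv, LinearMap.coe_mk, AddHom.coe_mk, LinearMap.mk₂_apply, coeff_mk,
        map_add, smul_eq_mul, coeff_mul, map_sum, repDeriv_mul, Finset.sum_add_distrib]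
      congr 1
      rw [← Finset.Nat.sum_antidiagonal_swap]
      rfl)

lemma seriesDerivation_apply (ξ : V) (f : (RepRing P)⟦X⟧) :
    seriesDerivation P ξ f = seriesDeriv P ξ f := rfl

lemma coeff_seriesDerivation (ξ : V) (f : (RepRing P)⟦X⟧) (n : ℕ) :
    coeff n (seriesDerivation P ξ f) = repDeriv ξ (coeff n f) := by
  simp [seriesDerivation_apply, seriesDeriv]

lemma seriesDerivation_C (ξ : V) (p : RepRing P) :
    seriesDerivation P ξ (C p) = C (repDeriv ξ p) := by
  ext1 n
  rw [coeff_seriesDerivation, coeff_C, coeff_C]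
  split_ifs <;> simp

lemma seriesDerivation_X (ξ : V) : seriesDerivation P ξ X = 0 := by
  ext1 n
  rw [coeff_seriesDerivation, coeff_X]
  split_ifs
  · rw [AddMonoidAlgebra.one_def, repDeriv_single]
    simp
  · simp

lemma seriesDerivation_formalExp (ξ : V) {a : (RepRing P)⟦X⟧} (ha : constantCoeff a = 0) :
    seriesDerivation P ξ (formalExp a) = formalExp a * seriesDerivation P ξ a :=
  derivation_formalExp ((seriesDerivation P ξ).restrictScalars ℤ) (fun f n h =>
    X_pow_dvd_iff.2 fun k hk => by
      change coeff k (seriesDerivation P ξ f) = 0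
      rw [coeff_seriesDerivation, X_pow_dvd_iff.1 h k (hk.trans n.lt_succ_self), map_zero]) ha

/-- The constant Fourier coefficient of the coefficient of `tⁿ`, i.e. the integral over `T`. -/
def constTerm (P : Submodule ℤ V) (n : ℕ) : (RepRing P)⟦X⟧ →ₗ[ℂ] ℂ where
  toFun f := (coeff n f).coeff 0
  map_add' f g := by simp
  map_smul' c f := by simp

lemma constTerm_apply (n : ℕ) (f : (RepRing P)⟦X⟧) : constTerm P n f = (coeff n f).coeff 0 := rfl

end Derivation

/-! ### The formal change of variables by `Φ_t` -/

section Phi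

open PowerSeries

variable {V : Type*} [NormedAddCommGroup V] [InnerProductSpace ℝ V] [FiniteDimensional ℝ V]
variable {P : Submodule ℤ V} {m : ℕ} (S : Fin m → Submodule ℝ V) (l : Fin m → ℕ)
  (v : VectorField P)

/-- The coordinates of `t ℓ⁻¹ v_t` in an orthonormal basis. -/
def displacement (i : Fin (Module.finrank ℝ V)) : (RepRing P)⟦X⟧ :=
  X * pairing (RepRing P)⟦X⟧ (stdOrthonormalBasis ℝ V i) (rescaled S l v)

/-- The Jacobian matrix of `Φ_t` in an orthonormal basis. -/
def jacobianMatrix : Matrix (Fin (Module.finrank ℝ V)) (Fin (Module.finrank ℝ V)) (RepRing P)⟦X⟧ :=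
  1 + Matrix.of fun i j => seriesDerivation P (stdOrthonormalBasis ℝ V j) (displacement S l v i)

/-- Passing to an orthonormal basis identifies the coordinate-free determinant with that of a matrix
of derivatives, to which the Piola identity applies. -/
lemma jacobianDet_eq : jacobianDet S l v = (jacobianMatrix S l v).det := by
  let b := Module.Basis.baseChange (RepRing P)⟦X⟧ (stdOrthonormalBasis ℝ V).toBasis
  have hb : ∀ z i, b.repr z i = pairing (RepRing P)⟦X⟧ (stdOrthonormalBasis ℝ V i) z := by
    intro z i
    induction z with
    | zero => simp
    | add x y hx hy => simp [hx, hy]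
    | tmul r x => simp [b, pairing_tmul, OrthonormalBasis.repr_apply_apply]
  rw [jacobianDet, ← LinearMap.det_toMatrix b]
  congr 1
  ext1 i j
  rw [LinearMap.toMatrix_apply, hb]
  simp only [LinearMap.add_apply, Module.End.one_apply, map_add, LinearMap.smul_apply, map_smul,
    LinearMap.comp_apply]
  rw [jacobianMatrix, Matrix.add_apply, Matrix.of_apply]
  congr 1
  · simp [b, pairing_tmul, OrthonormalBasis.inner_eq_ite, Matrix.one_apply]
  -- `ℓ⁻¹` acts on the factor `𝔱` and the derivative on the series, so the two commute.
  · have h1 : ((levelInv S l).baseChange (RepRing P)⟦X⟧) (v.differential (b j)) =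
        LinearMap.rTensor V (seriesDeriv P (stdOrthonormalBasis ℝ V j)) (rescaled S l v) := by
      simp only [VectorField.differential, b, rescaled]
      rw [Module.Basis.baseChange_apply, LinearMap.liftBaseChange_tmul, one_smul]
      simp only [LinearMap.flip_apply, LinearMap.comp_apply, LinearMap.coe_rTensorHom,
        OrthonormalBasis.coe_toBasis]
      induction v using TensorProduct.induction_on with
      | zero => simp
      | add x y hx hy => simp [hx, hy]
      | tmul r x => simp
    rw [h1, pairing_rTensor, displacement, Derivation.leibniz, seriesDerivation_X, smul_zero,
      add_zero]
    rfl

lemma constantCoeff_jacobianDet : constantCoeff (jacobianDet S l v) = 1 := by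
  rw [jacobianDet_eq, RingHom.map_det, jacobianMatrix, ← Matrix.det_one (n := Fin (Module.finrank ℝ V))]
  congr 1
  ext1 i j
  have : constantCoeff (seriesDerivation P (stdOrthonormalBasis ℝ V j) (displacement S l v i)) =
      0 := by
    rw [← coeff_zero_eq_constantCoeff_apply, coeff_seriesDerivation]
    simp [displacement]
  simp only [RingHom.mapMatrix_apply, Matrix.map_apply, Matrix.add_apply, Matrix.of_apply, map_add,
    this, add_zero, Matrix.one_apply]
  split_ifs <;> simp

lemma constantCoeff_eval_jacobianDet (γ : Jet P) :
    constantCoeff (γ.eval (jacobianDet S l v)) = 1 := by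
  rw [γ.constantCoeff_eval, constantCoeff_jacobianDet, repEval, AddMonoidAlgebra.one_def,
    linExt_single, character_zero, one_smul]

lemma phiCharacter_add (lam mu : weightLattice P) :
    phiCharacter S l v (lam + mu) = phiCharacter S l v lam * phiCharacter S l v mu := by
  rw [phiCharacter, phiCharacter, phiCharacter, Submodule.coe_add, pairing_add_left, mul_add,
    smul_add, formalExp_add (constantCoeff_smul_X_mul _ _) (constantCoeff_smul_X_mul _ _),
    show (AddMonoidAlgebra.single (lam + mu) 1 : RepRing P) = AddMonoidAlgebra.single lam 1 *
      AddMonoidAlgebra.single mu 1 by simp [AddMonoidAlgebra.single_mul_single], map_mul]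
  ring

lemma phiCharacter_zero : phiCharacter S l v 0 = 1 := by
  rw [phiCharacter, Submodule.coe_zero, pairing_zero_left, mul_zero, smul_zero, formalExp_zero,
    ← AddMonoidAlgebra.one_def, map_one, one_mul]

lemma constantCoeff_phiCharacter (lam : weightLattice P) :
    constantCoeff (phiCharacter S l v lam) = AddMonoidAlgebra.single lam 1 := by
  rw [phiCharacter, map_mul, constantCoeff_formalExp (constantCoeff_smul_X_mul _ _), mul_one]
  simp

/-- Chain rule: the identity part of the Jacobian comes from differentiating `u ^ lam`, the rest
from the exponent. This is the form required of `E` in `linearMap_mul_det_eq_zero`. -/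
lemma seriesDerivation_phiCharacter (lam : weightLattice P) (j : Fin (Module.finrank ℝ V)) :
    seriesDerivation P (stdOrthonormalBasis ℝ V j) (phiCharacter S l v lam) =
      phiCharacter S l v lam * ∑ i, (2 * Real.pi * Complex.I *
        ((⟪(lam : V), stdOrthonormalBasis ℝ V i⟫_ℝ : ℝ) : ℂ)) • jacobianMatrix S l v i j := by
  have h1 : ∀ a : ℂ, (C (AddMonoidAlgebra.single lam a) : (RepRing P)⟦X⟧) =
      a • C (AddMonoidAlgebra.single lam 1) := by
    intro a
    ext1 n
    rw [PowerSeries.coeff_smul, coeff_C, coeff_C]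
    split_ifs
    · rw [AddMonoidAlgebra.smul_single, smul_eq_mul, mul_one]
    · simp
  set c : Fin (Module.finrank ℝ V) → ℂ := fun i => 2 * Real.pi * Complex.I *
    ((⟪(lam : V), stdOrthonormalBasis ℝ V i⟫_ℝ : ℝ) : ℂ) with hc
  have h2 : (2 * Real.pi * Complex.I : ℂ) • (X * pairing (RepRing P)⟦X⟧ (lam : V)
      (rescaled S l v)) = ∑ i, c i • displacement S l v i := by
    rw [pairing_eq_sum, Finset.mul_sum, Finset.smul_sum]
    refine Finset.sum_congr rfl fun i _ => ?_
    rw [displacement, mul_smul_comm]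
    exact (mul_smul (2 * Real.pi * Complex.I : ℂ)
      ((⟪(lam : V), stdOrthonormalBasis ℝ V i⟫_ℝ : ℝ) : ℂ) _).symm
  have h3 : ∑ i, c i • (1 : Matrix _ _ (RepRing P)⟦X⟧) i j = c j • (1 : (RepRing P)⟦X⟧) := by
    rw [Finset.sum_eq_single j]
    · simp
    · intro i _ hij
      simp [hij]
    · simp
  change _ = _ * ∑ i, c i • _
  simp only [jacobianMatrix, Matrix.add_apply, smul_add, Finset.sum_add_distrib, h3,
    Matrix.of_apply]
  rw [phiCharacter, Derivation.leibniz, seriesDerivation_formalExp _ (constantCoeff_smul_X_mul _ _),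
    seriesDerivation_C, repDeriv_single, one_mul, h1 (2 * Real.pi * Complex.I *
    ((⟪(lam : V), stdOrthonormalBasis ℝ V j⟫_ℝ : ℝ) : ℂ)), h2, map_sum]
  simp only [Derivation.map_smul]
  rw [smul_eq_mul, smul_eq_mul, mul_add, mul_smul_comm, mul_smul_comm, mul_one, add_comm,
    mul_comm (formalExp _) (C _), mul_assoc (C _)]

lemma constTerm_seriesDerivation (n : ℕ) (ξ : V) (f : (RepRing P)⟦X⟧) :
    constTerm P n (seriesDerivation P ξ f) = 0 := by
  rw [constTerm_apply, coeff_seriesDerivation, coeff_zero_repDeriv]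

open scoped Classical in
/-- The formal change of variables `∫_T (u^lam ∘ Φ_t) det(dΦ_t) du = ∫_T u^lam du`. -/
lemma constTerm_phiCharacter_mul_jacobianDet (n : ℕ) (lam : weightLattice P) :
    constTerm P n (phiCharacter S l v lam * jacobianDet S l v) =
      if n = 0 ∧ lam = 0 then 1 else 0 := by
  have hcomm : ∀ (ξ ζ : V) (f : (RepRing P)⟦X⟧),
      seriesDerivation P ξ (seriesDerivation P ζ f) =
        seriesDerivation P ζ (seriesDerivation P ξ f) := fun ξ ζ f => by
    ext1 n
    simp only [coeff_seriesDerivation, repDeriv_comm ξ ζ]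
  rw [jacobianDet_eq]
  -- A nonzero weight makes the integrand a divergence; for weight zero only the Jacobian
  -- determinant is left, and its integral is that of `1`.
  rcases eq_or_ne lam 0 with rfl | hlam
  · rw [phiCharacter_zero, one_mul, jacobianMatrix, linearMap_det_eq (constTerm P n)
      (fun j => seriesDerivation P (stdOrthonormalBasis ℝ V j))
      (fun j f => constTerm_seriesDerivation n _ f) (fun j k f => hcomm _ _ f)
      (displacement S l v), constTerm_apply, coeff_one]
    split_ifs <;> simp_all
  · rw [if_neg (fun h => hlam h.2)]
    refine linearMap_mul_det_eq_zero (constTerm P n)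
      (fun j => seriesDerivation P (stdOrthonormalBasis ℝ V j))
      (fun j f => constTerm_seriesDerivation n _ f) _ (fun i j k => ?_) _ _
      (fun j => seriesDerivation_phiCharacter S l v lam j) ?_
    · have h1 : ∀ ξ, seriesDerivation P ξ ((1 : Matrix _ _ (RepRing P)⟦X⟧) i j) = 0 := by
        intro ξ
        rw [Matrix.one_apply]
        split_ifs <;> simp
      have h2 : ∀ ξ, seriesDerivation P ξ ((1 : Matrix _ _ (RepRing P)⟦X⟧) i k) = 0 := by
        intro ξ
        rw [Matrix.one_apply]
        split_ifs <;> simp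
      simp only [jacobianMatrix, Matrix.add_apply, map_add, h1, h2, zero_add, Matrix.of_apply]
      exact hcomm _ _ _
    · intro h
      refine hlam (Subtype.ext (InnerProductSpace.ext_inner_right_basis (stdOrthonormalBasis ℝ V).toBasis fun i => ?_))
      have := congrFun h i
      simpa [Real.pi_ne_zero] using this

end Phi

/-! ### The coroot lattice, its dual, and summability over it -/

section Lattice

variable {V : Type*} [NormedAddCommGroup V] [InnerProductSpace ℝ V] [FiniteDimensional ℝ V]
variable (P : Submodule ℤ V) [DiscreteTopology P] [IsZLattice ℝ P]

/-- The basis of `𝔱` given by the chosen `ℤ`-basis of `Π`. -/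
def realBasis : Module.Basis (Fin (Module.finrank ℤ P)) ℝ V :=
  (latticeBasis P).ofZLatticeBasis ℝ P

lemma realBasis_apply (i : Fin (Module.finrank ℤ P)) : realBasis P i = latticeBasis P i :=
  (latticeBasis P).ofZLatticeBasis_apply ℝ P i

lemma span_realBasis : Submodule.span ℤ (Set.range (realBasis P)) = P :=
  (latticeBasis P).ofZLatticeBasis_span ℝ P

lemma realBasis_mem (i : Fin (Module.finrank ℤ P)) : realBasis P i ∈ P := by
  rw [realBasis_apply]
  exact (latticeBasis P i).2

variable (V) in
lemma innerₗ_nondegenerate : (innerₗ V : LinearMap.BilinForm ℝ V).Nondegenerate := by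
  constructor
  · intro x hx
    exact inner_self_eq_zero.1 (hx x)
  · intro x hx
    exact inner_self_eq_zero.1 (hx x)

variable (V) in
lemma innerₗ_isSymm : LinearMap.BilinForm.IsSymm (innerₗ V) :=
  ⟨fun _ _ => real_inner_comm _ _⟩

/-- Double duality is what later recognizes elements of `Π` by their integral pairing with `Λ`. -/
lemma weightLattice_weightLattice : weightLattice (weightLattice P) = P := by
  conv_rhs => rw [← span_realBasis P]
  rw [weightLattice, weightLattice]
  conv_lhs => rw [← span_realBasis P]
  exact LinearMap.BilinForm.dualSubmodule_dualSubmodule_of_basis _ (innerₗ_nondegenerate V)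
    (innerₗ_isSymm V) _

lemma weightLattice_eq_span : weightLattice P = Submodule.span ℤ (Set.range
    (LinearMap.BilinForm.dualBasis (innerₗ V) (innerₗ_nondegenerate V) (realBasis P))) := by
  rw [weightLattice]
  conv_lhs => rw [← span_realBasis P]
  exact LinearMap.BilinForm.dualSubmodule_span_of_basis _ _ _

instance discreteTopology_weightLattice : DiscreteTopology (weightLattice P) := by
  rw [weightLattice_eq_span]
  infer_instance

variable {P} in
lemma exists_int_inner_realBasis (lam : weightLattice P) :
    ∃ n : Fin (Module.finrank ℤ P) → ℤ, ∀ i, (n i : ℝ) = ⟪(lam : V), realBasis P i⟫_ℝ := by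
  choose n hn using fun i => mem_weightLattice.1 lam.2 (realBasis P i) (realBasis_mem P i)
  exact ⟨n, hn⟩

/-- The coordinates of a weight in the basis dual to the chosen basis of `Π`. -/
def weightCoord (lam : weightLattice P) : Fin (Module.finrank ℤ P) → ℤ :=
  (exists_int_inner_realBasis lam).choose

variable {P} in
lemma weightCoord_spec (lam : weightLattice P) (i : Fin (Module.finrank ℤ P)) :
    (weightCoord P lam i : ℝ) = ⟪(lam : V), realBasis P i⟫_ℝ :=
  (exists_int_inner_realBasis lam).choose_spec i

lemma weightCoord_injective : Function.Injective (weightCoord P) := by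
  intro lam mu h
  refine Subtype.ext (InnerProductSpace.ext_inner_right_basis (realBasis P) fun i => ?_)
  rw [← weightCoord_spec, ← weightCoord_spec, h]

lemma weightCoord_surjective : Function.Surjective (weightCoord P) := by
  intro n
  let c := LinearMap.BilinForm.dualBasis (innerₗ V) (innerₗ_nondegenerate V) (realBasis P)
  have hc : ∀ j, c j ∈ weightLattice P := fun j => by
    rw [weightLattice_eq_span]
    exact Submodule.subset_span ⟨j, rfl⟩
  refine ⟨⟨∑ j, n j • c j, Submodule.sum_mem _ fun j _ => Submodule.smul_mem _ _ (hc j)⟩, ?_⟩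
  funext i
  refine Int.cast_injective (α := ℝ) ?_
  rw [weightCoord_spec, sum_inner]
  have h1 : ∀ j, ⟪c j, realBasis P i⟫_ℝ = if i = j then 1 else 0 := fun j =>
    LinearMap.BilinForm.apply_dualBasis_left (B := innerₗ V) (innerₗ_nondegenerate V)
      (realBasis P) j i
  have h2 : ∀ j, ⟪n j • c j, realBasis P i⟫_ℝ = if i = j then (n j : ℝ) else 0 := by
    intro j
    rw [← Int.cast_smul_eq_zsmul ℝ, real_inner_smul_left, h1]
    simp
  simp [h2]

/-- `Λ ≃ ℤᵈ`. -/
def weightEquiv : weightLattice P ≃ (Fin (Module.finrank ℤ P) → ℤ) :=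
  Equiv.ofBijective (weightCoord P) ⟨weightCoord_injective P, weightCoord_surjective P⟩

lemma inner_eq_sum_weightCoord (lam : weightLattice P) (s : Fin (Module.finrank ℤ P) → ℝ) :
    ⟪(lam : V), ∑ i, s i • (latticeBasis P i : V)⟫_ℝ = ∑ i, weightCoord P lam i * s i := by
  simp only [inner_sum, real_inner_smul_right, weightCoord_spec, realBasis_apply, mul_comm]

/-- Rapid decay in the weight gives absolute convergence. -/
lemma summable_of_norm_mul_pow_le {a : weightLattice P → ℂ}
    (ha : ∀ N : ℕ, ∃ C : ℝ, ∀ lam : weightLattice P, ‖a lam‖ * ‖(lam : V)‖ ^ N ≤ C) (k : ℕ) :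
    Summable fun lam : weightLattice P => ‖a lam‖ * ‖(lam : V)‖ ^ k := by
  -- An exponent above the rank makes `∑ ‖lam‖⁻¹ ^ N` converge.
  let N := Module.finrank ℤ (weightLattice P) + 1
  obtain ⟨C, hC⟩ := ha (k + N)
  have hs : Summable fun lam : weightLattice P => C * ‖(lam : V)‖⁻¹ ^ N :=
    (ZLattice.summable_norm_pow_inv (weightLattice P) N (Nat.lt_succ_self _)).mul_left C
  -- The comparison must omit `lam = 0`, where `‖lam‖⁻¹` is `0` by convention.
  refine Summable.of_norm_bounded_eventually hs ?_
  filter_upwards [(Set.finite_singleton (0 : weightLattice P)).compl_mem_cofinite] with lam hlam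
  have h0 : (lam : V) ≠ 0 := fun h => hlam (Subtype.ext h)
  have h1 := norm_pos_iff.2 h0
  rw [Real.norm_of_nonneg (by positivity), inv_pow, ← div_eq_mul_inv, le_div_iff₀ (by positivity),
    mul_assoc, ← pow_add]
  exact hC lam

end Lattice

/-! ### The level operator, the finite group `T_ℓ` and its characters -/

section Level

variable {V : Type*} [NormedAddCommGroup V] [InnerProductSpace ℝ V] [FiniteDimensional ℝ V]
variable {P : Submodule ℤ V} {m : ℕ} {S : Fin m → Submodule ℝ V}

lemma inner_scaleMap_left (S : Fin m → Submodule ℝ V) (c : Fin m → ℝ) (x y : V) :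
    ⟪scaleMap S c x, y⟫_ℝ = ⟪x, scaleMap S c y⟫_ℝ := by
  simp only [scaleMap, LinearMap.sum_apply, LinearMap.smul_apply, sum_inner, inner_sum,
    real_inner_smul_left, real_inner_smul_right, ContinuousLinearMap.coe_coe,
    Submodule.inner_starProjection_left_eq_right]

lemma IsIntegralDecomposition.sum_starProjection (h : IsIntegralDecomposition P S) (x : V) :
    ∑ i, (S i).starProjection x = x := by
  have hx : x ∈ ⨆ i, S i := by
    rw [h.internal.submodule_iSup_eq_top]
    trivial
  refine Submodule.iSup_induction S (motive := fun x => ∑ i, (S i).starProjection x = x) hx ?_ ?_ ?_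
  · intro i y hy
    rw [Finset.sum_eq_single i]
    · exact Submodule.starProjection_eq_self_iff.2 hy
    · intro j _ hji
      rw [Submodule.starProjection_apply_eq_zero_iff]
      exact (h.orthogonal i j hji.symm) hy
    · simp
  · simp
  · intro y z hy hz
    simp only [map_add, Finset.sum_add_distrib, hy, hz]

lemma IsIntegralDecomposition.scaleMap_scaleMap (h : IsIntegralDecomposition P S)
    {c d : Fin m → ℝ} (hcd : ∀ i, c i * d i = 1) (x : V) : scaleMap S c (scaleMap S d x) = x := by
  have h1 : ∀ i, (S i).starProjection (scaleMap S d x) = d i • (S i).starProjection x := by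
    intro i
    simp only [scaleMap, LinearMap.sum_apply, LinearMap.smul_apply, map_sum, map_smul,
      ContinuousLinearMap.coe_coe]
    rw [Finset.sum_eq_single i]
    · rw [Submodule.starProjection_eq_self_iff.2 (Submodule.starProjection_apply_mem _ _)]
    · intro j _ hji
      rw [(Submodule.starProjection_apply_eq_zero_iff _).2, smul_zero]
      exact (h.orthogonal j i hji) (Submodule.starProjection_apply_mem _ _)
    · simp
  rw [scaleMap, LinearMap.sum_apply]
  simp only [LinearMap.smul_apply, ContinuousLinearMap.coe_coe, h1, smul_smul, hcd, one_smul]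
  exact h.sum_starProjection x

variable {l : Fin m → ℕ}

lemma IsIntegralDecomposition.levelInv_level (h : IsIntegralDecomposition P S) (hl : ∀ i, 0 < l i)
    (x : V) : levelInv S l (level S l x) = x :=
  h.scaleMap_scaleMap (fun i => inv_mul_cancel₀ (Nat.cast_ne_zero.2 (hl i).ne')) x

lemma IsIntegralDecomposition.level_levelInv (h : IsIntegralDecomposition P S) (hl : ∀ i, 0 < l i)
    (x : V) : level S l (levelInv S l x) = x :=
  h.scaleMap_scaleMap (fun i => mul_inv_cancel₀ (Nat.cast_ne_zero.2 (hl i).ne')) x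

lemma levelWeight_injective (h : IsIntegralDecomposition P S) (hl : ∀ i, 0 < l i) :
    Function.Injective (levelWeight h l) := by
  intro η η' heq
  have h1 : level S l η = level S l η' := congrArg Subtype.val heq
  rw [Subtype.ext_iff, ← h.levelInv_level hl η, h1, h.levelInv_level hl]

lemma levelWeight_neg (h : IsIntegralDecomposition P S) (η : P) :
    levelWeight h l (-η) = -levelWeight h l η :=
  Subtype.ext (by simp [levelWeight])

lemma character_torus_add (lam : weightLattice P) (u u' : Torus P) :
    character P lam (u + u') = character P lam u * character P lam u' := by
  obtain ⟨x, rfl⟩ := P.mkQ_surjective u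
  obtain ⟨y, rfl⟩ := P.mkQ_surjective u'
  rw [← map_add, character_mk, character_mk, character_mk, ← Complex.exp_add, inner_add_right]
  push_cast
  rw [mul_add]

lemma character_mk_eq_one_iff (lam : weightLattice P) (x : V) :
    character P lam (P.mkQ x) = 1 ↔ ∃ n : ℤ, (n : ℝ) = ⟪(lam : V), x⟫_ℝ := by
  rw [character_mk, Complex.exp_eq_one_iff]
  refine exists_congr fun n => ?_
  have h0 : (2 * Real.pi * Complex.I : ℂ) ≠ 0 := by simp [Real.pi_ne_zero]
  rw [mul_comm (n : ℂ), mul_right_inj' h0, eq_comm]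
  norm_cast

lemma mkQ_mem_levelSubgroup {x : V} (hx : level S l x ∈ weightLattice P) :
    P.mkQ x ∈ levelSubgroup P S l :=
  Submodule.mem_map.2 ⟨x, hx, rfl⟩

lemma exists_of_mem_levelSubgroup {g : Torus P} (hg : g ∈ levelSubgroup P S l) :
    ∃ x, level S l x ∈ weightLattice P ∧ P.mkQ x = g := by
  obtain ⟨x, hx, rfl⟩ := Submodule.mem_map.1 hg
  exact ⟨x, hx, rfl⟩

lemma character_levelWeight (h : IsIntegralDecomposition P S) (η : P) {g : Torus P}
    (hg : g ∈ levelSubgroup P S l) : character P (levelWeight h l η) g = 1 := by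
  obtain ⟨x, hx, rfl⟩ := exists_of_mem_levelSubgroup hg
  rw [character_mk_eq_one_iff]
  obtain ⟨n, hn⟩ := mem_weightLattice.1 hx η η.2
  refine ⟨n, ?_⟩
  rw [hn]
  exact (inner_scaleMap_left S _ x η).trans (real_inner_comm _ _)

variable [DiscreteTopology P] [IsZLattice ℝ P]

/-- Triviality on `ℓ⁻¹ Λ` says that `ℓ⁻¹ mu` pairs integrally with `Λ`, as `ℓ⁻¹` is self-adjoint; by
double duality `ℓ⁻¹ mu ∈ Π`. -/
lemma exists_levelWeight_eq (h : IsIntegralDecomposition P S) (hl : ∀ i, 0 < l i)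
    (mu : weightLattice P) (hmu : ∀ g ∈ levelSubgroup P S l, character P mu g = 1) :
    ∃ η : P, levelWeight h l η = mu := by
  have h1 : levelInv S l mu ∈ weightLattice (weightLattice P) := by
    refine mem_weightLattice.2 fun nu hnu => ?_
    have h2 := hmu _ (mkQ_mem_levelSubgroup (x := levelInv S l nu) (P := P) (S := S) (l := l)
      (by rwa [h.level_levelInv hl]))
    rw [character_mk_eq_one_iff] at h2
    rwa [levelInv, inner_scaleMap_left]
  rw [weightLattice_weightLattice] at h1
  exact ⟨⟨_, h1⟩, Subtype.ext (h.level_levelInv hl _)⟩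

-- Orthogonality: a character that is nontrivial at some `g₀` has its sum multiplied by a number
-- other than `1` under translation by `g₀`. The characters trivial on `T_ℓ` are those in `ℓ Π`.
open scoped Classical in
lemma sum_character_levelSubgroup [Fintype (levelSubgroup P S l)] (h : IsIntegralDecomposition P S)
    (hl : ∀ i, 0 < l i) (mu : weightLattice P) :
    ∑ g : levelSubgroup P S l, character P mu g =
      if ∃ η : P, levelWeight h l η = mu then (Nat.card (levelSubgroup P S l) : ℂ) else 0 := by
  split_ifs with hmu
  · obtain ⟨η, rfl⟩ := hmu
    rw [Finset.sum_congr rfl fun g _ => character_levelWeight h η g.2]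
    simp
  · have h1 : ∃ g : levelSubgroup P S l, character P mu g ≠ 1 := by
      by_contra! hne
      exact hmu (exists_levelWeight_eq h hl mu fun g hg => hne ⟨g, hg⟩)
    obtain ⟨g₀, hg₀⟩ := h1
    have h2 : ∑ g : levelSubgroup P S l, character P mu g =
        character P mu g₀ * ∑ g : levelSubgroup P S l, character P mu g := by
      rw [Finset.mul_sum, ← Equiv.sum_comp (Equiv.addLeft g₀)]
      refine Finset.sum_congr rfl fun g _ => ?_
      rw [Equiv.coe_addLeft, Submodule.coe_add, character_torus_add]
    have h3 : (character P mu g₀ - 1) * ∑ g : levelSubgroup P S l, character P mu g = 0 := by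
      rw [sub_mul, one_mul, ← h2, sub_self]
    exact (mul_eq_zero.1 h3).resolve_left (sub_ne_zero.2 hg₀)

/-- Each class has a representative `y` in a bounded fundamental domain of `Π`. The integral
coordinates of `ℓ y` are `y · ℓ b_i`, hence bounded, which leaves finitely many weights. -/
lemma finite_levelSubgroup (h : IsIntegralDecomposition P S) (hl : ∀ i, 0 < l i) :
    Finite (levelSubgroup P S l) := by
  let b := realBasis P
  let F : (Fin (Module.finrank ℤ P) → ℤ) → Torus P := fun n =>
    P.mkQ (levelInv S l ((weightEquiv P).symm n))
  obtain ⟨R, hR⟩ := (ZSpan.fundamentalDomain_isBounded b).exists_norm_le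
  let C : Fin (Module.finrank ℤ P) → ℤ := fun i => ⌈R * ‖level S l (b i)‖⌉
  refine Set.Finite.subset ((Set.finite_Icc (-C) C).image F) fun g hg => ?_
  obtain ⟨x, hx, rfl⟩ := exists_of_mem_levelSubgroup hg
  set y := ZSpan.fract b x with hy
  have hyx : y = x - ZSpan.floor b x := rfl
  have hf : (ZSpan.floor b x : V) ∈ P := (span_realBasis P).le (ZSpan.floor b x).2
  have hyR : ‖y‖ ≤ R := hR _ (ZSpan.fract_mem_fundamentalDomain b x)
  have hyl : level S l y ∈ weightLattice P := by
    rw [hyx, map_sub]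
    exact sub_mem hx (h.level_mem l hf)
  have hmk : P.mkQ x = P.mkQ y := by
    rw [hyx, map_sub, (Submodule.Quotient.mk_eq_zero P).2 hf |> fun e => (e : P.mkQ _ = 0), sub_zero]
  have hb : ∀ i, |weightCoord P ⟨_, hyl⟩ i| ≤ C i := by
    intro i
    have h1 : |(weightCoord P ⟨_, hyl⟩ i : ℝ)| ≤ R * ‖level S l (b i)‖ := by
      rw [weightCoord_spec]
      simp only
      rw [level, inner_scaleMap_left]
      exact (abs_real_inner_le_norm _ _).trans (mul_le_mul_of_nonneg_right hyR (norm_nonneg _))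
    have h2 := h1.trans (Int.le_ceil _)
    exact_mod_cast h2
  refine ⟨weightCoord P ⟨_, hyl⟩, ⟨fun i => (abs_le.1 (hb i)).1, fun i => (abs_le.1 (hb i)).2⟩, ?_⟩
  have h3 : (weightEquiv P).symm (weightCoord P ⟨_, hyl⟩) = ⟨_, hyl⟩ :=
    (weightEquiv P).symm_apply_apply _
  simp only [F]
  rw [h3, hmk, h.levelInv_level hl]

end Level

/-! ### Integrals of derivatives of periodic functions -/

section Periodic

open MeasureTheory

/-- The divergence theorem on the unit cube for the field `G e_i`: the two faces orthogonal to `e_i`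
cancel by periodicity. -/
lemma integral_fderiv_single_of_periodic {d : ℕ} {G : (Fin d → ℝ) → ℂ} (hG : ContDiff ℝ 1 G)
    (i : Fin d) (hper : ∀ s, G (s + Pi.single i 1) = G s) :
    ∫ s in Set.Icc (0 : Fin d → ℝ) 1, fderiv ℝ G s (Pi.single i 1) = 0 := by
  cases d with
  | zero => exact i.elim0
  | succ n =>
    have hc : Continuous fun s => fderiv ℝ G s (Pi.single i 1) :=
      (hG.continuous_fderiv one_ne_zero).clm_apply continuous_const
    have hsum : ∀ s, ∑ j, (if j = i then fderiv ℝ G s else 0) (Pi.single j 1) =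
        fderiv ℝ G s (Pi.single i 1) := by
      intro s
      rw [Finset.sum_eq_single i]
      · simp
      · intro j _ hj
        simp [hj]
      · simp
    have h := integral_divergence_of_hasFDerivAt_off_countable' (0 : Fin (n + 1) → ℝ) 1
      zero_le_one (fun j s => if j = i then G s else 0)
      (fun j s => if j = i then fderiv ℝ G s else 0) ∅ Set.countable_empty
      (fun j => by split_ifs; exacts [hG.continuous.continuousOn, continuousOn_const])
      (fun s _ j => by
        split_ifs
        exacts [(hG.differentiable one_ne_zero s).hasFDerivAt, hasFDerivAt_const _ _])
      (by simp only [hsum]; exact hc.integrableOn_Icc)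
    simp only [hsum] at h
    rw [h]
    refine Finset.sum_eq_zero fun j _ => ?_
    rcases eq_or_ne j i with rfl | hj
    · rw [sub_eq_zero]
      refine integral_congr_ae (Filter.Eventually.of_forall fun x => ?_)
      have h1 : Fin.insertNth (α := fun _ => ℝ) j ((1 : Fin (n + 1) → ℝ) j) x =
          Fin.insertNth (α := fun _ => ℝ) j ((0 : Fin (n + 1) → ℝ) j) x + Pi.single j 1 := by
        funext k
        rcases eq_or_ne k j with rfl | hk
        · simp
        · obtain ⟨k, rfl⟩ := Fin.exists_succAbove_eq hk
          simp [hk]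
      simp only [if_true]
      rw [h1, hper]
    · simp [hj]

end Periodic

/-! ### Fourier coefficients of smooth functions and their decay -/

section Fourier

variable {V : Type*} [NormedAddCommGroup V] [InnerProductSpace ℝ V] [FiniteDimensional ℝ V]
variable {P : Submodule ℤ V}

/-- The real linear functional `x ↦ lam · x` on `𝔱`. -/
def weightFunctional (lam : weightLattice P) : V →L[ℝ] ℝ := innerSL ℝ (lam : V)

lemma weightFunctional_apply (lam : weightLattice P) (x : V) :
    weightFunctional lam x = ⟪(lam : V), x⟫_ℝ := rfl

variable (P) in
/-- A character as a smooth function on the torus. -/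
def characterFn (lam : weightLattice P) : SmoothFn P :=
  ⟨character P lam, by
    change ContDiff ℝ ∞ fun x : V => character P lam (P.mkQ x)
    simp only [character_mk]
    exact ((contDiff_const.mul (Complex.ofRealCLM.contDiff.comp
      (weightFunctional lam).contDiff))).cexp⟩

lemma pull_characterFn (lam : weightLattice P) (x : V) : pull (characterFn P lam) x =
    Complex.exp (2 * Real.pi * Complex.I * ((⟪(lam : V), x⟫_ℝ : ℝ) : ℂ)) :=
  character_mk P lam x

/-- The product of smooth functions on the torus. -/
def smoothMul (f g : SmoothFn P) : SmoothFn P :=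
  ⟨fun u => f.1 u * g.1 u, (contDiff_pull f).mul (contDiff_pull g)⟩

lemma pull_smoothMul (f g : SmoothFn P) : pull (smoothMul f g) = fun x => pull f x * pull g x := rfl

lemma pull_add_of_mem (f : SmoothFn P) {η : V} (hη : η ∈ P) (x : V) :
    pull f (x + η) = pull f x := by
  rw [pull, map_add, show P.mkQ η = 0 from (Submodule.Quotient.mk_eq_zero P).2 hη, add_zero]
  rfl

lemma fderiv_pull_add_of_mem (f : SmoothFn P) {η : V} (hη : η ∈ P) (x : V) :
    fderiv ℝ (pull f) (x + η) = fderiv ℝ (pull f) x := by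
  rw [← fderiv_comp_add_right]
  congr 1
  funext y
  exact pull_add_of_mem f hη y

/-- The derivative does not depend on the chosen logarithm, so directional derivatives descend to
the torus. -/
lemma fderiv_pull_logRep (f : SmoothFn P) (x : V) :
    fderiv ℝ (pull f) (logRep P (P.mkQ x)) = fderiv ℝ (pull f) x := by
  obtain ⟨η, hη, h⟩ := exists_logRep_mk P x
  rw [h, fderiv_pull_add_of_mem f hη]

/-- The derivative of a smooth function on the torus in the direction `ξ`. -/
def dirDeriv (ξ : V) (f : SmoothFn P) : SmoothFn P :=
  ⟨fun u => fderiv ℝ (pull f) (logRep P u) ξ, by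
    change ContDiff ℝ ∞ fun x : V => fderiv ℝ (pull f) (logRep P (P.mkQ x)) ξ
    simp only [fderiv_pull_logRep]
    exact ((contDiff_pull f).fderiv_right (m := ∞) (by simp)).clm_apply contDiff_const⟩

lemma pull_dirDeriv (ξ : V) (f : SmoothFn P) (x : V) :
    pull (dirDeriv ξ f) x = fderiv ℝ (pull f) x ξ := by
  rw [← fderiv_pull_logRep]
  rfl

lemma differentiable_pull (f : SmoothFn P) : Differentiable ℝ (pull f) :=
  (contDiff_pull f).differentiable (by simp)

lemma hasFDerivAt_pull_characterFn (lam : weightLattice P) (x : V) :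
    HasFDerivAt (pull (characterFn P lam)) ((pull (characterFn P lam) x *
      (2 * Real.pi * Complex.I)) • Complex.ofRealCLM.comp (weightFunctional lam)) x := by
  have h1 : pull (characterFn P lam) = fun x => Complex.exp (2 * Real.pi * Complex.I *
      Complex.ofRealCLM.comp (weightFunctional lam) x) := funext fun x => pull_characterFn lam x
  have h2 := (((Complex.ofRealCLM.comp (weightFunctional lam)).hasFDerivAt (x := x)).const_mul
    (2 * Real.pi * Complex.I)).cexp
  rw [h1]
  rwa [smul_smul] at h2

lemma dirDeriv_smoothMul_characterFn (ξ : V) (f : SmoothFn P) (lam : weightLattice P) :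
    dirDeriv ξ (smoothMul f (characterFn P lam)) = smoothMul (dirDeriv ξ f) (characterFn P lam) +
      (2 * Real.pi * Complex.I * ((⟪(lam : V), ξ⟫_ℝ : ℝ) : ℂ)) •
        smoothMul f (characterFn P lam) := by
  have key : ∀ x, pull (dirDeriv ξ (smoothMul f (characterFn P lam))) x =
      pull (smoothMul (dirDeriv ξ f) (characterFn P lam) +
      (2 * Real.pi * Complex.I * ((⟪(lam : V), ξ⟫_ℝ : ℝ) : ℂ)) •
        smoothMul f (characterFn P lam)) x := by
    intro x
    rw [pull_dirDeriv, pull_add, pull_smul, pull_smoothMul, Pi.add_apply, Pi.smul_apply,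
      pull_smoothMul]
    change (fderiv ℝ (pull f * pull (characterFn P lam)) x) ξ = pull (dirDeriv ξ f) x * _ + _
    rw [pull_dirDeriv, (((differentiable_pull f x).hasFDerivAt).mul (hasFDerivAt_pull_characterFn lam x)).fderiv]
    simp [weightFunctional_apply]
    ring
  refine Subtype.ext (funext fun u => ?_)
  obtain ⟨x, rfl⟩ := P.mkQ_surjective u
  exact key x

/-- The Laplacian on the torus. -/
def laplacian (f : SmoothFn P) : SmoothFn P :=
  ∑ j, dirDeriv (stdOrthonormalBasis ℝ V j) (dirDeriv (stdOrthonormalBasis ℝ V j) f)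

variable (P) [DiscreteTopology P] [IsZLattice ℝ P]

/-- Integration over the torus as a linear functional on smooth functions. -/
def integralₗ : SmoothFn P →ₗ[ℂ] ℂ where
  toFun f := torusIntegral P f.1
  map_add' f g := MeasureTheory.integral_add
    (integrableOn_torus P f.1 (contDiff_pull f).continuous)
    (integrableOn_torus P g.1 (contDiff_pull g).continuous)
  map_smul' c _ := MeasureTheory.integral_const_mul c _

variable {P}

lemma integralₗ_apply (f : SmoothFn P) : integralₗ P f = torusIntegral P f.1 := rfl

/-- In lattice coordinates the derivative along a basis vector is a partial derivative of a function
of period one. -/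
lemma integralₗ_dirDeriv_realBasis (i : Fin (Module.finrank ℤ P)) (f : SmoothFn P) :
    integralₗ P (dirDeriv (realBasis P i) f) = 0 := by
  let A : (Fin (Module.finrank ℤ P) → ℝ) →L[ℝ] V :=
    ∑ i, (ContinuousLinearMap.proj i).smulRight (latticeBasis P i : V)
  have hA : ∀ s, A s = ∑ i, s i • (latticeBasis P i : V) := fun s => by
    simp [A]
  have hAi : A (Pi.single i 1) = latticeBasis P i := by
    rw [hA, Finset.sum_eq_single i]
    · simp
    · intro j _ hj
      simp [hj]
    · simp
  have h := integral_fderiv_single_of_periodic (G := fun s => pull f (A s))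
    (((contDiff_pull f).of_le (by simp)).comp A.contDiff) i (fun s => by
      simp only [map_add, hAi]
      exact pull_add_of_mem f (latticeBasis P i).2 _)
  rw [integralₗ_apply, torusIntegral, ← h]
  refine MeasureTheory.integral_congr_ae (Filter.Eventually.of_forall fun s => ?_)
  have h1 : fderiv ℝ (fun s => pull f (A s)) s = (fderiv ℝ (pull f) (A s)).comp A :=
    ((differentiable_pull f _).hasFDerivAt.comp s A.hasFDerivAt).fderiv
  simp only [h1, ContinuousLinearMap.comp_apply, hAi]
  rw [← hA, ← realBasis_apply]
  exact pull_dirDeriv _ _ _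

lemma integralₗ_dirDeriv (ξ : V) (f : SmoothFn P) : integralₗ P (dirDeriv ξ f) = 0 := by
  have h : dirDeriv ξ f = ∑ i, ((realBasis P).repr ξ i : ℂ) • dirDeriv (realBasis P i) f := by
    refine Subtype.ext (funext fun u => ?_)
    change fderiv ℝ (pull f) (logRep P u) ξ = _
    conv_lhs => rw [← (realBasis P).sum_repr ξ]
    rw [map_sum, AddSubmonoidClass.coe_finsetSum, Finset.sum_apply]
    refine Finset.sum_congr rfl fun i _ => ?_
    rw [map_smul]
    rfl
  rw [h, map_sum]
  refine Finset.sum_eq_zero fun i _ => ?_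
  rw [map_smul, integralₗ_dirDeriv_realBasis, smul_zero]

/-- The Fourier coefficient `∫_T f(u) u^{-lam} du`. -/
def fourierCoeff (f : SmoothFn P) (lam : weightLattice P) : ℂ :=
  integralₗ P (smoothMul f (characterFn P (-lam)))

lemma fourierCoeff_add (f g : SmoothFn P) (lam : weightLattice P) :
    fourierCoeff (f + g) lam = fourierCoeff f lam + fourierCoeff g lam := by
  rw [fourierCoeff, fourierCoeff, fourierCoeff, ← map_add]
  congr 1
  exact Subtype.ext (funext fun u => add_mul _ _ _)

lemma fourierCoeff_sum {ι : Type*} (s : Finset ι) (f : ι → SmoothFn P) (lam : weightLattice P) :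
    fourierCoeff (∑ i ∈ s, f i) lam = ∑ i ∈ s, fourierCoeff (f i) lam := by
  let φ : SmoothFn P →+ ℂ := AddMonoidHom.mk' (fun f => fourierCoeff f lam)
    fun f g => fourierCoeff_add f g lam
  exact map_sum φ f s

/-- Integration by parts; the sign is absorbed by the conjugate character `-lam`. -/
lemma fourierCoeff_dirDeriv (ξ : V) (f : SmoothFn P) (lam : weightLattice P) :
    fourierCoeff (dirDeriv ξ f) lam =
      (2 * Real.pi * Complex.I * ((⟪(lam : V), ξ⟫_ℝ : ℝ) : ℂ)) * fourierCoeff f lam := by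
  have h := integralₗ_dirDeriv ξ (smoothMul f (characterFn P (-lam)))
  rw [dirDeriv_smoothMul_characterFn, map_add, map_smul] at h
  rw [fourierCoeff, fourierCoeff, eq_neg_of_add_eq_zero_left h, smul_eq_mul, Submodule.coe_neg,
    inner_neg_left]
  push_cast
  ring

lemma fourierCoeff_laplacian (f : SmoothFn P) (lam : weightLattice P) :
    fourierCoeff (laplacian f) lam = -((2 * Real.pi * ‖(lam : V)‖ : ℝ) ^ 2 : ℂ) *
      fourierCoeff f lam := by
  have h1 := (stdOrthonormalBasis ℝ V).sum_inner_mul_inner (lam : V) (lam : V)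
  rw [real_inner_self_eq_norm_sq] at h1
  have h2 : ((‖(lam : V)‖ ^ 2 : ℝ) : ℂ) = ∑ j, ((⟪(lam : V), stdOrthonormalBasis ℝ V j⟫_ℝ : ℝ) : ℂ) *
      ((⟪(lam : V), stdOrthonormalBasis ℝ V j⟫_ℝ : ℝ) : ℂ) := by
    rw [← h1]
    push_cast
    refine Finset.sum_congr rfl fun j _ => ?_
    rw [real_inner_comm (lam : V)]
  rw [laplacian, fourierCoeff_sum]
  simp only [fourierCoeff_dirDeriv]
  push_cast at h2 ⊢
  rw [mul_pow, h2, Finset.mul_sum, ← Finset.sum_neg_distrib, Finset.sum_mul]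
  refine Finset.sum_congr rfl fun j _ => ?_
  linear_combination (2 * Real.pi : ℂ) ^ 2 *
    ((⟪(lam : V), stdOrthonormalBasis ℝ V j⟫_ℝ : ℝ) : ℂ) ^ 2 * fourierCoeff f lam * Complex.I_sq

lemma exists_norm_fourierCoeff_le (f : SmoothFn P) : ∃ C : ℝ, ∀ lam, ‖fourierCoeff f lam‖ ≤ C := by
  refine ⟨∫ s in Set.Icc (0 : Fin (Module.finrank ℤ P) → ℝ) 1,
    ‖f.1 (P.mkQ (∑ i, s i • (latticeBasis P i : V)))‖, fun lam => ?_⟩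
  refine (MeasureTheory.norm_integral_le_integral_norm _).trans (le_of_eq ?_)
  refine MeasureTheory.integral_congr_ae (Filter.Eventually.of_forall fun s => ?_)
  change ‖f.1 _ * character P _ _‖ = _
  rw [norm_mul, norm_character, mul_one]

/-- Each Laplacian multiplies the coefficient by `-(2π‖lam‖)²`, while coefficients of any smooth
function are bounded. The Laplacian is applied `N` times. -/
lemma exists_norm_fourierCoeff_mul_pow_le (f : SmoothFn P) (N : ℕ) :
    ∃ C : ℝ, ∀ lam : weightLattice P, ‖fourierCoeff f lam‖ * ‖(lam : V)‖ ^ N ≤ C := by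
  have h1 : ∀ (k : ℕ) (lam : weightLattice P), ‖fourierCoeff (laplacian^[k] f) lam‖ =
      (2 * Real.pi * ‖(lam : V)‖) ^ (2 * k) * ‖fourierCoeff f lam‖ := by
    intro k lam
    induction k with
    | zero => simp
    | succ k ih =>
      rw [Function.iterate_succ_apply', fourierCoeff_laplacian, norm_mul, ih, norm_neg, norm_pow,
        Complex.norm_real, Real.norm_of_nonneg (by positivity)]
      ring
  obtain ⟨C, hC⟩ := exists_norm_fourierCoeff_le f
  obtain ⟨C', hC'⟩ := exists_norm_fourierCoeff_le (laplacian^[N] f)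
  refine ⟨C + C', fun lam => ?_⟩
  have h2 := hC' lam
  rw [h1] at h2
  -- Split at `‖lam‖ = 1`: the summand `1` covers short weights, the even power long ones.
  have h3 : ‖(lam : V)‖ ^ N ≤ 1 + (2 * Real.pi * ‖(lam : V)‖) ^ (2 * N) := by
    have hx := norm_nonneg (lam : V)
    have h4 : ‖(lam : V)‖ ≤ 2 * Real.pi * ‖(lam : V)‖ :=
      le_mul_of_one_le_left hx (by nlinarith [Real.pi_gt_three])
    rcases le_total ‖(lam : V)‖ 1 with h | h
    · exact (pow_le_one₀ hx h).trans (le_add_of_nonneg_right (by positivity))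
    · calc ‖(lam : V)‖ ^ N ≤ ‖(lam : V)‖ ^ (2 * N) := pow_le_pow_right₀ h (by omega)
        _ ≤ (2 * Real.pi * ‖(lam : V)‖) ^ (2 * N) := pow_le_pow_left₀ hx h4 _
        _ ≤ _ := le_add_of_nonneg_left zero_le_one
  calc ‖fourierCoeff f lam‖ * ‖(lam : V)‖ ^ N
      ≤ ‖fourierCoeff f lam‖ * (1 + (2 * Real.pi * ‖(lam : V)‖) ^ (2 * N)) :=
        mul_le_mul_of_nonneg_left h3 (norm_nonneg _)
    _ ≤ C + C' := by
        have := hC lam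
        linarith

lemma summable_norm_fourierCoeff_mul_pow (f : SmoothFn P) (k : ℕ) :
    Summable fun lam : weightLattice P => ‖fourierCoeff f lam‖ * ‖(lam : V)‖ ^ k :=
  summable_of_norm_mul_pow_le P (exists_norm_fourierCoeff_mul_pow_le f) k

end Fourier

/-! ### Fourier inversion by transport to the standard torus -/

section Inversion

variable {V : Type*} [NormedAddCommGroup V] [InnerProductSpace ℝ V] [FiniteDimensional ℝ V]
variable {P : Submodule ℤ V} [DiscreteTopology P] [IsZLattice ℝ P]

lemma isOpenQuotientMap_toUnitAddTorus (d : Type*) : IsOpenQuotientMap fun (s : d → ℝ) (i : d) =>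
    ((s i : ℝ) : UnitAddCircle) :=
  IsOpenQuotientMap.piMap fun _ => QuotientAddGroup.isOpenQuotientMap_mk

variable (P) in
/-- The point of `T` with given coordinates in the chosen basis of `Π`. -/
def coordPoint (s : Fin (Module.finrank ℤ P) → ℝ) : Torus P :=
  P.mkQ (∑ i, s i • (latticeBasis P i : V))

lemma coordPoint_eq_of_coe_eq {s s' : Fin (Module.finrank ℤ P) → ℝ}
    (h : ∀ i, ((s i : ℝ) : UnitAddCircle) = s' i) : coordPoint P s = coordPoint P s' := by
  rw [coordPoint, coordPoint, ← sub_eq_zero, ← map_sub, ← Finset.sum_sub_distrib]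
  refine (Submodule.Quotient.mk_eq_zero P).2 (P.sum_mem fun i _ => ?_)
  obtain ⟨n, hn⟩ := AddSubgroup.mem_zmultiples_iff.1 (QuotientAddGroup.eq_iff_sub_mem.1 (h i))
  rw [← sub_smul, ← hn]
  have := P.smul_mem n (latticeBasis P i).2
  rwa [← Int.cast_smul_eq_zsmul ℝ, ← zsmul_one] at this

lemma coordPoint_surjective : Function.Surjective (coordPoint P) := by
  intro u
  obtain ⟨x, rfl⟩ := P.mkQ_surjective u
  refine ⟨(realBasis P).repr x, ?_⟩
  rw [coordPoint]
  simp only [← realBasis_apply]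
  rw [(realBasis P).sum_repr]

lemma character_coordPoint (lam : weightLattice P) (s : Fin (Module.finrank ℤ P) → ℝ) :
    character P lam (coordPoint P s) =
      UnitAddTorus.mFourier (weightCoord P lam) fun i => ((s i : ℝ) : UnitAddCircle) := by
  rw [coordPoint, character_mk, inner_eq_sum_weightCoord]
  simp only [UnitAddTorus.mFourier, ContinuousMap.coe_mk, fourier_coe_apply]
  rw [← Complex.exp_sum]
  congr 1
  push_cast
  rw [Finset.mul_sum]
  refine Finset.sum_congr rfl fun i _ => ?_
  ring

/-- The function on the standard torus corresponding to a smooth function on `T`. -/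
lemma exists_unitAddTorus_lift (f : SmoothFn P) :
    ∃ F : C(UnitAddTorus (Fin (Module.finrank ℤ P)), ℂ),
      ∀ s : Fin (Module.finrank ℤ P) → ℝ, F (fun i => s i) = f.1 (coordPoint P s) := by
  let q : (Fin (Module.finrank ℤ P) → ℝ) → UnitAddTorus (Fin (Module.finrank ℤ P)) :=
    fun s i => s i
  have hq : IsOpenQuotientMap q := isOpenQuotientMap_toUnitAddTorus _
  let F : UnitAddTorus (Fin (Module.finrank ℤ P)) → ℂ := fun x =>
    f.1 (coordPoint P (Function.surjInv hq.surjective x))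
  have hF : ∀ s, F (q s) = f.1 (coordPoint P s) := fun s => by
    have h1 := Function.surjInv_eq hq.surjective (q s)
    exact congrArg f.1 (coordPoint_eq_of_coe_eq fun i => congrFun h1 i)
  refine ⟨⟨F, ?_⟩, hF⟩
  rw [hq.isQuotientMap.continuous_iff]
  have h2 : F ∘ q = fun s => pull f (∑ i, s i • (latticeBasis P i : V)) := funext hF
  rw [h2]
  exact (contDiff_pull f).continuous.comp (by fun_prop)

lemma weightCoord_neg (lam : weightLattice P) : weightCoord P (-lam) = -weightCoord P lam := by
  funext i
  refine Int.cast_injective (α := ℝ) ?_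
  rw [weightCoord_spec, Pi.neg_apply, Int.cast_neg, weightCoord_spec, Submodule.coe_neg,
    inner_neg_left]

lemma mFourierCoeff_lift {f : SmoothFn P} {F : C(UnitAddTorus (Fin (Module.finrank ℤ P)), ℂ)}
    (hF : ∀ s : Fin (Module.finrank ℤ P) → ℝ, F (fun i => s i) = f.1 (coordPoint P s))
    (lam : weightLattice P) :
    UnitAddTorus.mFourierCoeff F (weightCoord P lam) = fourierCoeff f lam := by
  rw [UnitAddTorus.mFourierCoeff_eq_integral F _ 0, fourierCoeff, integralₗ_apply, torusIntegral]
  have h1 : {x : Fin (Module.finrank ℤ P) → ℝ | ∀ i, x i ∈ Set.Ioc ((0 : Fin (Module.finrank ℤ P) → ℝ) i)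
      ((0 : Fin (Module.finrank ℤ P) → ℝ) i + 1)} =
      Set.pi Set.univ fun i => Set.Ioc ((0 : Fin (Module.finrank ℤ P) → ℝ) i)
        ((1 : Fin (Module.finrank ℤ P) → ℝ) i) := by
    ext x
    simp
  -- The half-open and the closed unit cube differ by a null set.
  rw [h1, MeasureTheory.volume_pi, MeasureTheory.setIntegral_congr_set MeasureTheory.Measure.univ_pi_Ioc_ae_eq_Icc]
  refine MeasureTheory.integral_congr_ae (Filter.Eventually.of_forall fun s => ?_)
  simp only
  rw [hF, ← weightCoord_neg, ← character_coordPoint, smul_eq_mul, mul_comm]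
  rfl

/-- Fourier inversion for smooth functions on `T`. -/
lemma hasSum_fourierCoeff_mul_character (f : SmoothFn P) (u : Torus P) :
    HasSum (fun lam => fourierCoeff f lam * character P lam u) (f.1 u) := by
  obtain ⟨F, hF⟩ := exists_unitAddTorus_lift f
  obtain ⟨s, rfl⟩ := coordPoint_surjective u
  -- Rapid decay makes the coefficients absolutely summable, which is what pointwise convergence of
  -- the Fourier series requires.
  have hs : Summable (UnitAddTorus.mFourierCoeff F) := by
    rw [← (weightEquiv P).summable_iff]
    refine Summable.of_norm ?_
    have := summable_norm_fourierCoeff_mul_pow f 0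
    simp only [pow_zero, mul_one] at this
    exact this.congr fun lam => congrArg norm (mFourierCoeff_lift hF lam).symm
  have h1 := UnitAddTorus.hasSum_mFourier_series_apply_of_summable hs (fun i => (s i : UnitAddCircle))
  rw [← (weightEquiv P).hasSum_iff, hF] at h1
  convert h1 using 2 with lam
  rw [character_coordPoint, ← mFourierCoeff_lift hF]
  rfl

end Inversion

/-! ### Taylor expansion of characters and of Fourier series at a jet -/

section CharacterDerivatives

variable {V : Type*} [NormedAddCommGroup V] [InnerProductSpace ℝ V] [FiniteDimensional ℝ V]
variable {P : Submodule ℤ V}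

lemma iteratedDeriv_cexp_mul_ofReal (n : ℕ) (c : ℂ) :
    iteratedDeriv n (fun r : ℝ => Complex.exp (c * r)) =
      fun r : ℝ => c ^ n * Complex.exp (c * r) := by
  induction n with
  | zero => simp
  | succ n ih =>
    rw [iteratedDeriv_succ, ih]
    funext r
    have h : HasDerivAt (fun r : ℝ => c ^ n * Complex.exp (c * r))
        (c ^ n * (Complex.exp (c * r) * (c * 1))) r :=
      ((Complex.ofRealCLM.hasDerivAt.const_mul c).cexp).const_mul _
    rw [h.deriv]
    ring

lemma iteratedFDeriv_pull_characterFn (lam : weightLattice P) (k : ℕ) (x : V) (w : Fin k → V) :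
    iteratedFDeriv ℝ k (pull (characterFn P lam)) x w =
      (∏ j, (2 * Real.pi * Complex.I * ((⟪(lam : V), w j⟫_ℝ : ℝ) : ℂ))) *
        pull (characterFn P lam) x := by
  have h1 : pull (characterFn P lam) =
      (fun r : ℝ => Complex.exp (2 * Real.pi * Complex.I * r)) ∘ weightFunctional lam :=
    funext fun x => pull_characterFn lam x
  have h2 : ContDiff ℝ k fun r : ℝ => Complex.exp (2 * Real.pi * Complex.I * r) :=
    (contDiff_const.mul Complex.ofRealCLM.contDiff).cexp
  rw [h1, (weightFunctional lam).iteratedFDeriv_comp_right h2 x le_rfl,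
    ContinuousMultilinearMap.compContinuousLinearMap_apply,
    iteratedFDeriv_apply_eq_iteratedDeriv_mul_prod, iteratedDeriv_cexp_mul_ofReal,
    Finset.prod_mul_distrib, Finset.prod_const, Finset.card_univ, Fintype.card_fin]
  simp only [weightFunctional_apply, Function.comp_apply, Complex.real_smul, Complex.ofReal_prod]
  ring

lemma norm_iteratedFDeriv_pull_characterFn_le (lam : weightLattice P) (k : ℕ) (x : V) :
    ‖iteratedFDeriv ℝ k (pull (characterFn P lam)) x‖ ≤ (2 * Real.pi * ‖(lam : V)‖) ^ k := by
  refine ContinuousMultilinearMap.opNorm_le_bound (by positivity) fun w => ?_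
  rw [iteratedFDeriv_pull_characterFn, norm_mul, show ‖pull (characterFn P lam) x‖ = 1 from
    norm_character lam _, mul_one, norm_prod]
  calc ∏ j, ‖(2 * Real.pi * Complex.I * ((⟪(lam : V), w j⟫_ℝ : ℝ) : ℂ))‖
      ≤ ∏ j, (2 * Real.pi * ‖(lam : V)‖) * ‖w j‖ := by
        refine Finset.prod_le_prod (fun _ _ => norm_nonneg _) fun j _ => ?_
        have h := abs_real_inner_le_norm (lam : V) (w j)
        simp only [norm_mul, Complex.norm_real, Complex.norm_I, mul_one, Complex.norm_ofNat,
          Real.norm_of_nonneg Real.pi_pos.le, Real.norm_eq_abs]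
        exact (mul_le_mul_of_nonneg_left h Real.two_pi_pos.le).trans_eq (mul_assoc _ _ _).symm
    _ = _ := by simp [Finset.prod_mul_distrib]

-- The Taylor substitution and the exponential formula agree on characters: expanding the `k`-th
-- power of `∑ c i x i` over all maps from `Fin k` reproduces the sum of partial derivatives of
-- order `k`.
open PowerSeries in
lemma taylorCoeff_characterFn (γ : Jet P) (n : ℕ) (lam : weightLattice P) :
    γ.taylorCoeff n (characterFn P lam) = coeff n (γ.character lam) := by
  rw [Jet.character, PowerSeries.coeff_smul, coeff_formalExp
    (γ.constantCoeff_smul_pairing_log _ _) n.lt_succ_self, Jet.taylorCoeff, Finset.smul_sum]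
  refine Finset.sum_congr rfl fun k _ => ?_
  have h1 : pull (characterFn P lam) (logRep P γ.base) = character P lam γ.base := by
    rw [pull_characterFn]
    rfl
  set c : Fin (Module.finrank ℝ V) → ℂ := fun i =>
    2 * Real.pi * Complex.I * ((⟪(lam : V), stdOrthonormalBasis ℝ V i⟫_ℝ : ℝ) : ℂ) with hc
  have h2 : (2 * Real.pi * Complex.I : ℂ) • pairing ℂ⟦X⟧ (lam : V) γ.log =
      ∑ i, c i • pairing ℂ⟦X⟧ (stdOrthonormalBasis ℝ V i) γ.log := by
    rw [pairing_eq_sum, Finset.smul_sum]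
    refine Finset.sum_congr rfl fun i _ => ?_
    exact (mul_smul (2 * Real.pi * Complex.I : ℂ)
      ((⟪(lam : V), stdOrthonormalBasis ℝ V i⟫_ℝ : ℝ) : ℂ) _).symm
  have h3 : (∑ i, c i • pairing ℂ⟦X⟧ (stdOrthonormalBasis ℝ V i) γ.log) ^ k =
      ∑ i : Fin k → Fin (Module.finrank ℝ V), (∏ j, c (i j)) •
        ∏ j, pairing ℂ⟦X⟧ (stdOrthonormalBasis ℝ V (i j)) γ.log := by
    rw [← Fintype.piFinset_univ, ← Fin.prod_const, Finset.prod_univ_sum]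
    refine Finset.sum_congr rfl fun i _ => ?_
    rw [Finset.prod_smul]
  rw [h2, h3, map_sum, smul_eq_mul, smul_eq_mul, mul_left_comm]
  congr 1
  rw [Finset.mul_sum]
  refine Finset.sum_congr rfl fun i _ => ?_
  rw [iteratedFDeriv_pull_characterFn, h1, PowerSeries.coeff_smul, smul_eq_mul, hc]
  ring

variable [DiscreteTopology P] [IsZLattice ℝ P]

/-- Termwise differentiation is justified by the summability of `‖fourierCoeff f lam‖ * (2π‖lam‖) ^
j` for every `j`. -/
lemma hasSum_iteratedFDeriv_pull (f : SmoothFn P) (k : ℕ) (x : V) (w : Fin k → V) :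
    HasSum (fun lam => fourierCoeff f lam * iteratedFDeriv ℝ k (pull (characterFn P lam)) x w)
      (iteratedFDeriv ℝ k (pull f) x w) := by
  have hf : pull f = fun y => ∑' lam, (fourierCoeff f lam • pull (characterFn P lam)) y :=
    funext fun y => (hasSum_fourierCoeff_mul_character f (P.mkQ y)).tsum_eq.symm
  have hcd : ∀ lam (N : ℕ∞), ContDiff ℝ N (pull (characterFn P lam)) := fun lam N =>
    (contDiff_pull _).of_le (by exact_mod_cast le_top)
  have hit : ∀ (j : ℕ) lam y, iteratedFDeriv ℝ j (fourierCoeff f lam • pull (characterFn P lam)) y =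
      fourierCoeff f lam • iteratedFDeriv ℝ j (pull (characterFn P lam)) y := fun j lam y =>
    iteratedFDeriv_const_smul_apply (hcd lam j).contDiffAt
  let b : ℕ → weightLattice P → ℝ := fun j lam =>
    ‖fourierCoeff f lam‖ * (2 * Real.pi * ‖(lam : V)‖) ^ j
  have hb : ∀ j, Summable (b j) := fun j => by
    refine ((summable_norm_fourierCoeff_mul_pow f j).mul_left ((2 * Real.pi) ^ j)).congr
      fun lam => ?_
    simp only [b]
    ring
  have hle : ∀ (j : ℕ) lam y,
      ‖iteratedFDeriv ℝ j (fourierCoeff f lam • pull (characterFn P lam)) y‖ ≤ b j lam := by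
    intro j lam y
    rw [hit, norm_smul]
    exact mul_le_mul_of_nonneg_left (norm_iteratedFDeriv_pull_characterFn_le lam j y)
      (norm_nonneg _)
  have h1 := iteratedFDeriv_tsum_apply (N := (k : ℕ∞))
    (f := fun lam => fourierCoeff f lam • pull (characterFn P lam))
    (fun lam => (hcd lam k).const_smul (fourierCoeff f lam))
    (fun j _ => hb j) (fun j lam y _ => hle j lam y) le_rfl x
  have h2 : HasSum (fun lam => iteratedFDeriv ℝ k (fourierCoeff f lam •
      pull (characterFn P lam)) x) (iteratedFDeriv ℝ k (pull f) x) := by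
    rw [hf, h1]
    exact (Summable.of_norm_bounded (hb k) fun lam => hle k lam x).hasSum
  have h3 := (ContinuousMultilinearMap.apply ℝ (fun _ : Fin k => V) ℂ w).hasSum h2
  refine h3.congr_fun fun lam => ?_
  rw [hit]
  rfl

/-- The values at a jet of a smooth function and of its Fourier series agree. -/
lemma hasSum_taylorCoeff (γ : Jet P) (n : ℕ) (f : SmoothFn P) :
    HasSum (fun lam => fourierCoeff f lam * PowerSeries.coeff n (γ.character lam))
      (γ.taylorCoeff n f) := by
  simp only [← taylorCoeff_characterFn, Jet.taylorCoeff]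
  have h := hasSum_sum (s := Finset.range (n + 1)) fun k _ =>
    (hasSum_sum (s := (Finset.univ : Finset (Fin k → Fin (Module.finrank ℝ V)))) fun i _ =>
      (hasSum_iteratedFDeriv_pull f k (logRep P γ.base) fun j =>
        stdOrthonormalBasis ℝ V (i j)).mul_right (PowerSeries.coeff n
          (∏ j, pairing ℂ⟦X⟧ (stdOrthonormalBasis ℝ V (i j)) γ.log))).mul_left
      ((k.factorial : ℂ))⁻¹
  refine h.congr_fun fun lam => ?_
  simp only [Finset.mul_sum]
  refine Finset.sum_congr rfl fun k _ => Finset.sum_congr rfl fun i _ => ?_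
  ring

end CharacterDerivatives

/-! ### Triangular reduction to leading terms -/

section Successive

open PowerSeries

variable {V : Type*} [NormedAddCommGroup V] [InnerProductSpace ℝ V] [FiniteDimensional ℝ V]
variable {P : Submodule ℤ V}

/-- Commuting with `X` determines the functional by its values on constant series: the remainder, a
multiple of `X ^ (n + 1)`, does not reach degree `n`. -/
lemma coeff_eq_sum_range (φ : (RepRing P)⟦X⟧ →ₗ[ℂ] ℂ⟦X⟧) (hφ : ∀ f, φ (X * f) = X * φ f)
    (f : (RepRing P)⟦X⟧) (n : ℕ) :
    coeff n (φ f) = ∑ i ∈ Finset.range (n + 1), coeff (n - i) (φ (C (coeff i f))) := by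
  have hpow : ∀ (k : ℕ) g, φ (X ^ k * g) = X ^ k * φ g := by
    intro k g
    induction k with
    | zero => simp
    | succ k ih => rw [pow_succ', mul_assoc, hφ, ih, pow_succ', mul_assoc]
  obtain ⟨g, hg⟩ := X_pow_dvd_sub_sum f (n + 1)
  rw [sub_eq_iff_eq_add] at hg
  conv_lhs => rw [hg]
  rw [map_add, hpow, map_sum, map_add, map_sum, X_pow_dvd_iff.1 (dvd_mul_right _ _) n n.lt_succ_self,
    zero_add]
  refine Finset.sum_congr rfl fun i hi => ?_
  rw [hpow, coeff_X_pow_mul', if_pos (Nat.lt_succ_iff.1 (Finset.mem_range.1 hi))]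

/-- Functionals on `ℂ R(T)[[t]]` that agree on a system of series with leading terms `u^mu` agree
on all of `ℂ R(T)`. -/
lemma hasSum_coeff_of_leading {ι : Type*} (φ : ι → (RepRing P)⟦X⟧ →ₗ[ℂ] ℂ⟦X⟧)
    (hφ : ∀ i f, φ i (X * f) = X * φ i f) (ψ : (RepRing P)⟦X⟧ →ₗ[ℂ] ℂ⟦X⟧)
    (hψ : ∀ f, ψ (X * f) = X * ψ f) (A : weightLattice P → (RepRing P)⟦X⟧)
    (hA : ∀ mu, coeff 0 (A mu) = AddMonoidAlgebra.single mu 1)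
    (h : ∀ mu n, HasSum (fun i => coeff n (φ i (A mu))) (coeff n (ψ (A mu)))) (n : ℕ)
    (p : RepRing P) : HasSum (fun i => coeff n (φ i (C p))) (coeff n (ψ (C p))) := by
  induction n using Nat.strong_induction_on generalizing p with
  | _ n ih =>
    induction p using AddMonoidAlgebra.induction_linear with
    | zero => simp
    | add p q hp hq => simpa using hp.add hq
    | single mu c =>
      have hc : (C (AddMonoidAlgebra.single mu c) : (RepRing P)⟦X⟧) =
          c • C (coeff 0 (A mu)) := by
        rw [hA]
        ext1 k
        rw [PowerSeries.coeff_smul, coeff_C, coeff_C]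
        split_ifs
        · rw [AddMonoidAlgebra.smul_single, smul_eq_mul, mul_one]
        · simp
      -- The higher coefficients of `A mu` are arbitrary elements of `ℂ R(T)`, but enter only in
      -- degrees below `n`, where the induction hypothesis holds for every `p`. Subtracting them
      -- isolates the leading term.
      have h1 : HasSum (fun i => ∑ k ∈ Finset.range n,
          coeff (n - (k + 1)) (φ i (C (coeff (k + 1) (A mu)))))
          (∑ k ∈ Finset.range n, coeff (n - (k + 1)) (ψ (C (coeff (k + 1) (A mu))))) :=
        hasSum_sum fun k hk => ih _ (by have := Finset.mem_range.1 hk; omega) _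
      have h2 := (h mu n).sub h1
      have h3 : ∀ χ : (RepRing P)⟦X⟧ →ₗ[ℂ] ℂ⟦X⟧, (∀ f, χ (X * f) = X * χ f) →
          coeff n (χ (A mu)) - ∑ k ∈ Finset.range n,
            coeff (n - (k + 1)) (χ (C (coeff (k + 1) (A mu)))) =
          coeff n (χ (C (coeff 0 (A mu)))) := by
        intro χ hχ
        rw [coeff_eq_sum_range χ hχ, Finset.sum_range_succ', add_sub_cancel_left, Nat.sub_zero]
      rw [h3 ψ hψ] at h2
      simp only [h3 (φ _) (hφ _)] at h2
      rw [hc]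
      simpa only [map_smul, PowerSeries.coeff_smul, smul_eq_mul] using h2.mul_left c

end Successive

/-! ### Poisson summation against characters -/

section CharacterPoisson

open PowerSeries

variable {V : Type*} [NormedAddCommGroup V] [InnerProductSpace ℝ V] [FiniteDimensional ℝ V]
variable {P : Submodule ℤ V} {m : ℕ} {S : Fin m → Submodule ℝ V}

variable (P) in
/-- The integral over `T`, coefficient by coefficient in `t`. -/
def constSeries : (RepRing P)⟦X⟧ →ₗ[ℂ] ℂ⟦X⟧ where
  toFun f := PowerSeries.mk fun n => constTerm P n f
  map_add' f g := by ext n; simp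
  map_smul' c f := by ext n; simp

lemma coeff_constSeries (n : ℕ) (f : (RepRing P)⟦X⟧) :
    coeff n (constSeries P f) = (coeff n f).coeff 0 := by
  simp [constSeries, constTerm_apply]

lemma constSeries_X_mul (f : (RepRing P)⟦X⟧) : constSeries P (X * f) = X * constSeries P f := by
  ext n
  cases n <;> simp [coeff_constSeries, coeff_succ_X_mul]

variable [DiscreteTopology P] [IsZLattice ℝ P] {l : Fin m → ℕ}

/-- The Poisson summation formula for characters. -/
lemma hasSum_coeff_constSeries (hS : IsIntegralDecomposition P S) (hl : ∀ i, 0 < l i)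
    (v : VectorField P) [Fintype (levelSubgroup P S l)] {γ : levelSubgroup P S l → Jet P}
    (hγ : ∀ g : levelSubgroup P S l, phiJet S l v (γ g) = Jet.const (g : Torus P))
    (n : ℕ) (p : RepRing P) :
    HasSum (fun η : P => coeff n (constSeries P (C p * phiCharacter S l v (levelWeight hS l η))))
      (coeff n ((Nat.card (levelSubgroup P S l) : ℂ)⁻¹ • ∑ g : levelSubgroup P S l,
        (γ g).eval (C p) * ((γ g).eval (jacobianDet S l v))⁻¹)) := by
  classical
  let φ : P → (RepRing P)⟦X⟧ →ₗ[ℂ] ℂ⟦X⟧ := fun η =>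
    (constSeries P).comp (LinearMap.mulRight ℂ (phiCharacter S l v (levelWeight hS l η)))
  let ψ : (RepRing P)⟦X⟧ →ₗ[ℂ] ℂ⟦X⟧ := (Nat.card (levelSubgroup P S l) : ℂ)⁻¹ •
    ∑ g : levelSubgroup P S l,
      (LinearMap.mulRight ℂ ((γ g).eval (jacobianDet S l v))⁻¹).comp (γ g).eval
  have hφ : ∀ η f, φ η f = constSeries P (f * phiCharacter S l v (levelWeight hS l η)) :=
    fun η f => rfl
  have hψ : ∀ f, ψ f = (Nat.card (levelSubgroup P S l) : ℂ)⁻¹ • ∑ g : levelSubgroup P S l,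
      (γ g).eval f * ((γ g).eval (jacobianDet S l v))⁻¹ := fun f => by
    simp [ψ, LinearMap.sum_apply]
  have key := hasSum_coeff_of_leading φ
    (fun η f => by rw [hφ, hφ, mul_assoc, constSeries_X_mul]) ψ
    (fun f => by
      rw [hψ, hψ, mul_smul_comm, Finset.mul_sum]
      simp only [Jet.eval_X_mul, mul_assoc])
    -- The factor `det(dΦ_t)` is what permits the change of variables on the left, and it cancels
    -- the denominator on the right.
    (fun mu => phiCharacter S l v mu * jacobianDet S l v)
    (fun mu => by
      rw [coeff_zero_eq_constantCoeff_apply, map_mul, constantCoeff_phiCharacter,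
        constantCoeff_jacobianDet, mul_one])
    (fun mu n => by
      have h1 : ∀ g : levelSubgroup P S l, (γ g).eval (phiCharacter S l v mu * jacobianDet S l v) *
          ((γ g).eval (jacobianDet S l v))⁻¹ = C (character P mu g) := by
        intro g
        rw [(γ g).eval_mul, mul_assoc, PowerSeries.mul_inv_cancel, mul_one,
          eval_phiCharacter_of_phiJet_eq_const (hγ g)]
        rw [constantCoeff_eval_jacobianDet]
        exact one_ne_zero
      have h2 : coeff n (ψ (phiCharacter S l v mu * jacobianDet S l v)) =
          if n = 0 ∧ ∃ η : P, levelWeight hS l η = mu then 1 else 0 := by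
        rw [hψ]
        simp only [h1]
        rw [← map_sum, sum_character_levelSubgroup hS hl, PowerSeries.coeff_smul, coeff_C]
        by_cases hn : n = 0 <;> by_cases hmu : ∃ η : P, levelWeight hS l η = mu <;>
          simp [hn, hmu]
      have h3 : ∀ η, coeff n (φ η (phiCharacter S l v mu * jacobianDet S l v)) =
          if n = 0 ∧ mu + levelWeight hS l η = 0 then 1 else 0 := by
        intro η
        rw [hφ, mul_right_comm, ← phiCharacter_add, coeff_constSeries, ← constTerm_apply,
          constTerm_phiCharacter_mul_jacobianDet]
      simp only [h2, h3]
      split_ifs with h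
      · obtain ⟨rfl, η, rfl⟩ := h
        -- Since `ℓ` is injective, exactly one lattice point contributes to the sum.
        have h4 : ∀ η', levelWeight hS l η + levelWeight hS l η' = 0 ↔ η' = -η := fun η' => by
          rw [add_eq_zero_iff_neg_eq, ← levelWeight_neg,
            (levelWeight_injective hS hl).eq_iff, eq_comm]
        simp only [true_and, h4]
        exact hasSum_ite_eq (-η) 1
      · have h4 : ∀ η, ¬(n = 0 ∧ mu + levelWeight hS l η = 0) := by
          rintro η ⟨hn, hmu⟩
          refine h ⟨hn, -η, ?_⟩
          rw [levelWeight_neg, ← add_eq_zero_iff_neg_eq'.1 hmu]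
        simp only [if_neg (h4 _)]
        exact hasSum_zero)
    n p
  simpa only [hφ, hψ] using key

end CharacterPoisson

/-! ### Absolute convergence and Poisson summation for test functions -/

section Convergence

open PowerSeries

variable {V : Type*} [NormedAddCommGroup V] [InnerProductSpace ℝ V] [FiniteDimensional ℝ V]
variable {P : Submodule ℤ V} {m : ℕ} {S : Fin m → Submodule ℝ V} {l : Fin m → ℕ}

/-- Isolates the dependence on `lam`: polynomials in `lam` of degree at most `n`, times `u ^ lam`,
times elements of `ℂ R(T)` independent of `lam`. -/
lemma coeff_phiCharacter (v : VectorField P) (lam : weightLattice P) (n : ℕ) :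
    coeff n (phiCharacter S l v lam) = ∑ k ∈ Finset.range (n + 1),
      ∑ i : Fin k → Fin (Module.finrank ℝ V), (((k.factorial : ℂ))⁻¹ *
        ∏ j, (2 * Real.pi * Complex.I *
          ((⟪(lam : V), stdOrthonormalBasis ℝ V (i j)⟫_ℝ : ℝ) : ℂ))) •
        (AddMonoidAlgebra.single lam 1 * coeff n (∏ j, displacement S l v (i j))) := by
  set c : Fin (Module.finrank ℝ V) → ℂ := fun i =>
    2 * Real.pi * Complex.I * ((⟪(lam : V), stdOrthonormalBasis ℝ V i⟫_ℝ : ℝ) : ℂ) with hc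
  have h1 : (2 * Real.pi * Complex.I : ℂ) • (X * pairing (RepRing P)⟦X⟧ (lam : V)
      (rescaled S l v)) = ∑ i, c i • displacement S l v i := by
    rw [pairing_eq_sum, Finset.mul_sum, Finset.smul_sum]
    refine Finset.sum_congr rfl fun i _ => ?_
    rw [displacement, mul_smul_comm]
    exact (mul_smul (2 * Real.pi * Complex.I : ℂ)
      ((⟪(lam : V), stdOrthonormalBasis ℝ V i⟫_ℝ : ℝ) : ℂ) _).symm
  have h2 : ∀ k : ℕ, (∑ i, c i • displacement S l v i) ^ k =
      ∑ i : Fin k → Fin (Module.finrank ℝ V), (∏ j, c (i j)) • ∏ j, displacement S l v (i j) := by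
    intro k
    rw [← Fintype.piFinset_univ, ← Fin.prod_const, Finset.prod_univ_sum]
    refine Finset.sum_congr rfl fun i _ => ?_
    rw [Finset.prod_smul]
  have h3 := constantCoeff_smul_X_mul (2 * Real.pi * Complex.I : ℂ)
    (pairing (RepRing P)⟦X⟧ (lam : V) (rescaled S l v))
  rw [phiCharacter, coeff_C_mul, coeff_formalExp h3 n.lt_succ_self, h1, Finset.mul_sum]
  refine Finset.sum_congr rfl fun k _ => ?_
  rw [h2, map_sum, Finset.smul_sum, Finset.mul_sum]
  refine Finset.sum_congr rfl fun i _ => ?_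
  rw [PowerSeries.coeff_smul, smul_smul, mul_smul_comm]

variable [DiscreteTopology P] [IsZLattice ℝ P]

lemma summable_norm_fourierCoeff_mul_add_pow (f : SmoothFn P) (k : ℕ) {s : ℝ} (hs : 0 ≤ s) :
    Summable fun lam : weightLattice P => ‖fourierCoeff f lam‖ * (‖(lam : V)‖ + s) ^ k := by
  have h0 := summable_norm_fourierCoeff_mul_pow f 0
  have h1 := ((summable_norm_fourierCoeff_mul_pow f k).add (h0.mul_right (s ^ k))).mul_left
    (2 ^ (k - 1) : ℝ)
  refine Summable.of_nonneg_of_le (fun lam => by positivity) (fun lam => ?_) h1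
  have h2 := add_pow_le (norm_nonneg (lam : V)) hs k
  calc _ ≤ ‖fourierCoeff f lam‖ * (2 ^ (k - 1) * (‖(lam : V)‖ ^ k + s ^ k)) :=
        mul_le_mul_of_nonneg_left h2 (norm_nonneg _)
    _ = _ := by rw [pow_zero]; ring

/-- The double series of Fourier coefficients of a function against those of the terms on the left
hand side converges absolutely. -/
lemma summable_fourierCoeff_mul_coeff_phiCharacter (hS : IsIntegralDecomposition P S)
    (hl : ∀ i, 0 < l i) (v : VectorField P) (f : SmoothFn P) (n : ℕ) :
    Summable fun x : P × weightLattice P => fourierCoeff f x.2 *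
      (coeff n (phiCharacter S l v (levelWeight hS l x.1))).coeff (-x.2) := by
  classical
  have key : ∀ (k : ℕ) (i : Fin k → Fin (Module.finrank ℝ V)) (r : RepRing P),
      Summable fun x : P × weightLattice P => fourierCoeff f x.2 * (((∏ j, (2 * Real.pi *
        Complex.I * ((⟪(levelWeight hS l x.1 : V), stdOrthonormalBasis ℝ V (i j)⟫_ℝ : ℝ) : ℂ))) *
        ((AddMonoidAlgebra.single (levelWeight hS l x.1) 1 * r : RepRing P).coeff (-x.2)))) := by
    intro k i r
    induction r using AddMonoidAlgebra.induction_linear with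
    | zero => simp
    | add p q hp hq => simpa [mul_add] using hp.add hq
    | single sig a =>
      -- For a monomial `r = a u ^ sig`, a term is nonzero only if `mu = -(ℓ η + sig)`, so the
      -- double series is supported on a graph over `Π`.
      let e : P → P × weightLattice P := fun η => (η, -(levelWeight hS l η + sig))
      have he : Function.Injective e := fun η η' h => congrArg Prod.fst h
      rw [← he.summable_iff]
      · have hinj : Function.Injective fun η : P => -(levelWeight hS l η + sig) := fun η η' h =>
          levelWeight_injective hS hl (add_right_cancel (neg_injective h))
        have h1 := ((summable_norm_fourierCoeff_mul_add_pow f k (norm_nonneg (sig : V))).comp_injective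
          hinj).mul_right ((2 * Real.pi) ^ k * ‖a‖)
        refine Summable.of_norm_bounded h1 fun η => ?_
        -- The growth in `ℓ η` is bounded in terms of the Fourier weight `-(ℓ η + sig)`, up to the
        -- fixed shift `‖sig‖`, so rapid decay absorbs it.
        have h2 : ‖(levelWeight hS l η : V)‖ ≤ ‖((-(levelWeight hS l η + sig) : weightLattice P) : V)‖
            + ‖(sig : V)‖ := by
          have := norm_sub_le ((levelWeight hS l η : V) + sig) sig
          rwa [add_sub_cancel_right, ← norm_neg ((levelWeight hS l η : V) + sig)] at this
        have h3 : ‖∏ j, (2 * Real.pi * Complex.I * ((⟪(levelWeight hS l η : V),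
            stdOrthonormalBasis ℝ V (i j)⟫_ℝ : ℝ) : ℂ))‖ ≤
            (2 * Real.pi) ^ k * (‖((-(levelWeight hS l η + sig) : weightLattice P) : V)‖
            + ‖(sig : V)‖) ^ k := by
          rw [norm_prod, ← mul_pow]
          refine (Finset.prod_le_prod (g := fun _ => 2 * Real.pi *
            (‖((-(levelWeight hS l η + sig) : weightLattice P) : V)‖ + ‖(sig : V)‖))
            (fun _ _ => norm_nonneg _) fun j _ => ?_).trans_eq (by simp)
          have h := abs_real_inner_le_norm (levelWeight hS l η : V) (stdOrthonormalBasis ℝ V (i j))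
          rw [OrthonormalBasis.norm_eq_one, mul_one] at h
          simp only [norm_mul, Complex.norm_real, Complex.norm_I, mul_one, Complex.norm_ofNat,
            Real.norm_of_nonneg Real.pi_pos.le, Real.norm_eq_abs]
          exact mul_le_mul_of_nonneg_left (h.trans h2) Real.two_pi_pos.le
        simp only [Function.comp_apply, e, AddMonoidAlgebra.single_mul_single, neg_neg,
          AddMonoidAlgebra.coeff_single, Finsupp.single_eq_same, one_mul, norm_mul]
        calc _ ≤ ‖fourierCoeff f (-(levelWeight hS l η + sig))‖ * (((2 * Real.pi) ^ k *
              (‖((-(levelWeight hS l η + sig) : weightLattice P) : V)‖ + ‖(sig : V)‖) ^ k) * ‖a‖) := by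
              gcongr
          _ = _ := by ring
      · rintro ⟨η, mu⟩ hx
        have hne : levelWeight hS l η + sig ≠ -mu := fun h =>
          hx ⟨η, Prod.ext rfl (neg_eq_iff_eq_neg.2 h)⟩
        simp [AddMonoidAlgebra.single_mul_single, hne.symm]
  simp only [coeff_phiCharacter, AddMonoidAlgebra.coeff_sum, Finsupp.finsetSum_apply, Finset.mul_sum,
    AddMonoidAlgebra.coeff_smul_apply]
  refine summable_sum fun k _ => summable_sum fun i _ => ?_
  refine ((key k i (coeff n (∏ j, displacement S l v (i j)))).mul_left
    ((k.factorial : ℂ))⁻¹).congr fun x => ?_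
  rw [smul_eq_mul]
  ring

lemma repDist_apply (p : RepRing P) (f : SmoothFn P) :
    (repDist P p).1 f = linExt P (fun lam => fourierCoeff f (-lam)) p := by
  change torusIntegral P (fun u => f.1 u * repEval P p u) = _
  induction p using AddMonoidAlgebra.induction_linear with
  | zero => simp [repEval, torusIntegral]
  | add p q hp hq =>
    rw [map_add, ← hp, ← hq, torusIntegral, torusIntegral, torusIntegral,
      ← MeasureTheory.integral_add
        (integrableOn_torus P (fun u => f.1 u * repEval P p u) (continuous_mul_repEval P f p))
        (integrableOn_torus P (fun u => f.1 u * repEval P q u) (continuous_mul_repEval P f q))]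
    refine MeasureTheory.integral_congr_ae (Filter.Eventually.of_forall fun s => ?_)
    simp only [repEval, map_add, mul_add]
  | single lam c =>
    rw [linExt_single, fourierCoeff, ← map_smul, integralₗ_apply, neg_neg]
    congr 1
    funext u
    rw [repEval, linExt_single, smul_eq_mul, mul_left_comm]
    rfl

/-- A finite sum written over all of `Λ`, so that it can serve as the inner sum of the double
series. -/
lemma hasSum_repDist_apply (p : RepRing P) (f : SmoothFn P) :
    HasSum (fun mu => fourierCoeff f mu * p.coeff (-mu)) ((repDist P p).1 f) := by
  classical
  rw [repDist_apply]
  induction p using AddMonoidAlgebra.induction_linear with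
  | zero => simp
  | add p q hp hq => simpa [mul_add] using hp.add hq
  | single lam c =>
    rw [linExt_single]
    convert hasSum_ite_eq (-lam) (c • fourierCoeff f (-lam)) using 2 with mu
    rw [AddMonoidAlgebra.coeff_single, Finsupp.single_apply]
    by_cases h : mu = -lam
    · simp [h, mul_comm]
    · have h' : ¬lam = -mu := fun h' => h (by rw [h', neg_neg])
      simp [h, h']

/-- The Poisson summation formula for smooth test functions. -/
lemma hasSum_repDist_coeff_phiCharacter (hS : IsIntegralDecomposition P S)
    (hl : ∀ i, 0 < l i) (v : VectorField P) [Fintype (levelSubgroup P S l)]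
    {γ : levelSubgroup P S l → Jet P}
    (hγ : ∀ g : levelSubgroup P S l, phiJet S l v (γ g) = Jet.const (g : Torus P))
    (n : ℕ) (f : SmoothFn P) :
    HasSum (fun η : P => (repDist P (coeff n (phiCharacter S l v (levelWeight hS l η)))).1 f)
      ((Nat.card (levelSubgroup P S l) : ℂ)⁻¹ * ∑ g : levelSubgroup P S l,
        ∑ p ∈ Finset.HasAntidiagonal.antidiagonal n,
          coeff p.1 ((γ g).eval (jacobianDet S l v))⁻¹ * (γ g).taylorCoeff p.2 f) := by
  -- One absolutely convergent double series is summed in both orders: over `Λ` first it gives the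
  -- left-hand terms, over `Π` first the formula for characters.
  have h1 := (summable_fourierCoeff_mul_coeff_phiCharacter hS hl v f n).hasSum
  have h2 := h1.prod_fiberwise fun η =>
    hasSum_repDist_apply (coeff n (phiCharacter S l v (levelWeight hS l η))) f
  have h3 : ∀ mu, HasSum (fun η : P => fourierCoeff f mu *
      (coeff n (phiCharacter S l v (levelWeight hS l η))).coeff (-mu))
      (fourierCoeff f mu * ((Nat.card (levelSubgroup P S l) : ℂ)⁻¹ * ∑ g : levelSubgroup P S l,
        ∑ p ∈ Finset.HasAntidiagonal.antidiagonal n,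
          coeff p.1 ((γ g).eval (jacobianDet S l v))⁻¹ * coeff p.2 ((γ g).character mu))) := by
    intro mu
    have h4 := hasSum_coeff_constSeries hS hl v hγ n (AddMonoidAlgebra.single mu 1)
    refine HasSum.mul_left _ ?_
    have h8 : ∀ η : P, coeff n (constSeries P (C (AddMonoidAlgebra.single mu 1) *
        phiCharacter S l v (levelWeight hS l η))) =
        (coeff n (phiCharacter S l v (levelWeight hS l η))).coeff (-mu) := by
      intro η
      rw [coeff_constSeries, coeff_C_mul, AddMonoidAlgebra.coeff_single_mul_apply]
      simp
    simp only [h8] at h4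
    rw [PowerSeries.coeff_smul, map_sum, smul_eq_mul] at h4
    have h9 : ∀ g, coeff n ((γ g).eval (C (AddMonoidAlgebra.single mu 1)) *
        ((γ g).eval (jacobianDet S l v))⁻¹) = ∑ p ∈ Finset.HasAntidiagonal.antidiagonal n,
          coeff p.1 ((γ g).eval (jacobianDet S l v))⁻¹ * coeff p.2 ((γ g).character mu) := by
      intro g
      rw [(γ g).eval_C, linExt_single, one_smul, mul_comm, coeff_mul]
    simp only [h9] at h4
    exact h4
  have h5 := ((Equiv.prodComm _ _).hasSum_iff.2 h1).prod_fiberwise h3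
  have h6 : HasSum (fun mu => fourierCoeff f mu * ((Nat.card (levelSubgroup P S l) : ℂ)⁻¹ *
      ∑ g : levelSubgroup P S l, ∑ p ∈ Finset.HasAntidiagonal.antidiagonal n,
        coeff p.1 ((γ g).eval (jacobianDet S l v))⁻¹ * coeff p.2 ((γ g).character mu)))
      ((Nat.card (levelSubgroup P S l) : ℂ)⁻¹ * ∑ g : levelSubgroup P S l,
        ∑ p ∈ Finset.HasAntidiagonal.antidiagonal n,
          coeff p.1 ((γ g).eval (jacobianDet S l v))⁻¹ * (γ g).taylorCoeff p.2 f) := by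
    have h7 := (hasSum_sum (s := (Finset.univ : Finset (levelSubgroup P S l))) fun g _ =>
      hasSum_sum (s := Finset.HasAntidiagonal.antidiagonal n) fun p _ =>
        (hasSum_taylorCoeff (γ g) p.2 f).mul_left
          (coeff p.1 ((γ g).eval (jacobianDet S l v))⁻¹)).mul_left
      ((Nat.card (levelSubgroup P S l) : ℂ)⁻¹)
    refine h7.congr_fun fun mu => ?_
    rw [mul_left_comm, Finset.mul_sum]
    congr 1
    refine Finset.sum_congr rfl fun g _ => ?_
    rw [Finset.mul_sum]
    refine Finset.sum_congr rfl fun p _ => ?_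
    rw [mul_left_comm]
  rwa [h5.unique h6] at h2

variable (P) in
/-- Evaluation of distributions on test functions. -/
def testHom : TorusDist P →+ (SmoothFn P → ℂ) where
  toFun D f := D.1 f
  map_zero' := rfl
  map_add' _ _ := rfl

lemma smul_sum_seriesMul_apply {ι : Type*} [Fintype ι] (c : ℂ) (a : ι → ℂ⟦X⟧)
    (D : ι → DistSeries P) (n : ℕ) (f : SmoothFn P) :
    ((c • ∑ i, seriesMul (a i) (D i)) n).1 f =
      c * ∑ i, ∑ p ∈ Finset.HasAntidiagonal.antidiagonal n, coeff p.1 (a i) * (D i p.2).1 f := by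
  change c * testHom P ((∑ i, seriesMul (a i) (D i)) n) f = _
  rw [Finset.sum_apply, map_sum, Finset.sum_apply]
  congr 1
  refine Finset.sum_congr rfl fun i _ => ?_
  rw [seriesMul, map_sum, Finset.sum_apply]
  rfl

/-- The topology is the initial one for the maps taking a coefficient and pairing it with a test
function. -/
lemma hasSum_distSeries_iff {ι : Type*} {D : ι → DistSeries P} {E : DistSeries P} :
    HasSum D E ↔ ∀ n f, HasSum (fun i => (D i n).1 f) ((E n).1 f) := by
  rw [Pi.hasSum]
  refine forall_congr' fun n => ?_
  have hind : Topology.IsInducing (testHom P) := ⟨rfl⟩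
  exact (hind.hasSum_iff (g := testHom P) _ _).symm.trans Pi.hasSum

end Convergence

end FormalTorus

end

/-! ### The formal Poisson summation formula -/

theorem mainTheorem6 {V : Type*} [NormedAddCommGroup V] [InnerProductSpace ℝ V]
    [FiniteDimensional ℝ V] (P : Submodule ℤ V) [DiscreteTopology P] [IsZLattice ℝ P]
    {m : ℕ} (S : Fin m → Submodule ℝ V) (hS : IsIntegralDecomposition P S)
    (l : Fin m → ℕ) (hl : ∀ i, 0 < l i) (v : VectorField P) :
    Finite (levelSubgroup P S l) ∧
    (∀ g : Torus P, ∃! γ : Jet P, phiJet S l v γ = Jet.const g) ∧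
    ∀ γ : levelSubgroup P S l → Jet P,
      (∀ g : levelSubgroup P S l, phiJet S l v (γ g) = Jet.const (g : Torus P)) →
      (∀ g : levelSubgroup P S l,
        PowerSeries.constantCoeff ((γ g).eval (jacobianDet S l v)) = 1) ∧
      HasSum (fun η : P => repSeriesDist P (phiCharacter S l v (levelWeight hS l η)))
        ((Nat.card (levelSubgroup P S l) : ℂ)⁻¹ • ∑ᶠ g : levelSubgroup P S l,
          seriesMul ((γ g).eval (jacobianDet S l v))⁻¹ (γ g).delta) := by
  have hfin := finite_levelSubgroup hS hl
  refine ⟨hfin, existsUnique_phiJet_eq_const S l v, fun γ hγ =>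
    ⟨fun g => constantCoeff_eval_jacobianDet S l v (γ g), ?_⟩⟩
  have := Fintype.ofFinite (levelSubgroup P S l)
  rw [hasSum_distSeries_iff, finsum_eq_sum_of_fintype]
  intro n f
  rw [smul_sum_seriesMul_apply]
  exact hasSum_repDist_coeff_phiCharacter hS hl v hγ n f
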